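/- **Conventions.** A spacetime $(M,g)$ is a connected, Hausdorff, second countable, finite-dimensional smooth manifold $M$ with a $C^2$ Lorentzian metric $g$ of signature $(-,+,\dots,+)$ and a time orientation. Timelike and causal curves are future-directed and piecewise $C^1$, with timelike (respectively causal and nonzero) one-sided velocities at all times. Write $p\ll q$ if there is a timelike curve from $p$ to $q$, and set $I^+(p)=\{q: p\ll q\}$, $I^-(p)=\{q: q\ll p\}$. The Lorentzian distance $d:M\times M\to[0,\infty]$ is $$d(p,q)=\sup_\gamma \int \sqrt{-g(\dot\gamma,\dot\gamma)}\,dt ,$$ the supremum being over all causal curves $\gamma$ from $p$ to $q$, with $d(p,q)=0$ if there are none. Put $d_p=d(p,\cdot)$ and $d^p=d(\cdot,p)$. The spacetime $(M,g)$ is * *causally continuous* if it is distinguishing (for all $p,q\in M$, $I^+(p)=I^+(q)$ implies $p=q$, and $I^-(p)=I^-(q)$ implies $p=q$) and the set-valued maps $I^+$ and $I^-$ are outer continuous, where $F$ is outer continuous if for every $x\in M$ and every compact $K\subset M\setminus\overline{F(x)}$ there is a neighborhood $U$ of $x$ such that $K\subset M\setminus\overline{F(y)}$ for all $y\in U$;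 * *weakly $d$-distinguishing* if for all $p,q\in M$, $d_p=d_q$ and $d^p=d^q$ together imply $p=q$; * *$d$-reflective* if for all $p,q\in M$, $d^p\le d^q \Leftrightarrow d_q\le d_p$. **Theorem.** A spacetime $(M,g)$ is causally continuous if and only if it is weakly $d$-distinguishing and $d$-reflective. -/

import Mathlib

open Set MeasureTheory Topology Bundle
open scoped Manifold ENNReal ContDiff

noncomputable section

namespace Lorentz

/-- A Lorentzian metric of class `C^2` on a manifold `M` modelled on `E`: a `C^2` field of symmetric
bilinear forms of signature `(-,+,...,+)` on the tangent spaces. -/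
structure LorentzianMetric (E : Type*) [NormedAddCommGroup E] [NormedSpace ℝ E]
    (M : Type*) [TopologicalSpace M] [ChartedSpace E M] [IsManifold 𝓘(ℝ, E) ∞ M] where
  /-- The bilinear form on each tangent space. -/
  val (x : M) : TangentSpace 𝓘(ℝ, E) x →L[ℝ] TangentSpace 𝓘(ℝ, E) x →L[ℝ] ℝ
  symm (x : M) (v w : TangentSpace 𝓘(ℝ, E) x) : val x v w = val x w v
  /-- Signature `(-,+,...,+)`: some vector is negative, and the form is positive definite on
  the orthogonal complement of that vector. -/
  signature (x : M) : ∃ v : TangentSpace 𝓘(ℝ, E) x, val x v v < 0 ∧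
    ∀ w : TangentSpace 𝓘(ℝ, E) x, val x v w = 0 → w ≠ 0 → 0 < val x w w
  contMDiff : ContMDiff 𝓘(ℝ, E) (𝓘(ℝ, E).prod 𝓘(ℝ, E →L[ℝ] E →L[ℝ] ℝ)) 2
    (fun x : M => TotalSpace.mk' (E →L[ℝ] E →L[ℝ] ℝ)
      (E := fun x : M => TangentSpace 𝓘(ℝ, E) x →L[ℝ] TangentSpace 𝓘(ℝ, E) x →L[ℝ] ℝ)
      x (val x))

variable {E : Type*} [NormedAddCommGroup E] [NormedSpace ℝ E]
  {M : Type*} [TopologicalSpace M] [ChartedSpace E M] [IsManifold 𝓘(ℝ, E) ∞ M]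

/-- A time orientation, given by a continuous timelike vector field, which is declared to be
future-directed. -/
structure TimeOrientation (g : LorentzianMetric E M) where
  /-- The vector field. -/
  field (x : M) : TangentSpace 𝓘(ℝ, E) x
  timelike (x : M) : g.val x (field x) (field x) < 0
  continuous : Continuous (fun x : M => (⟨x, field x⟩ : TangentBundle 𝓘(ℝ, E) M))

/-- Future-directed timelike tangent vectors. -/
def IsFutureTimelike (g : LorentzianMetric E M) (τ : TimeOrientation g) (x : M)
    (v : TangentSpace 𝓘(ℝ, E) x) : Prop :=
  g.val x v v < 0 ∧ g.val x (τ.field x) v < 0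

/-- Future-directed causal (timelike or lightlike, nonzero) tangent vectors. -/
def IsFutureCausal (g : LorentzianMetric E M) (τ : TimeOrientation g) (x : M)
    (v : TangentSpace 𝓘(ℝ, E) x) : Prop :=
  v ≠ 0 ∧ g.val x v v ≤ 0 ∧ g.val x (τ.field x) v < 0

/-- `γ` is a piecewise `C^1` curve on `[a, b]` whose velocity satisfies `P` at all times; at the
finitely many break points this is required of both one-sided velocities. -/
def IsPiecewiseC1With (P : ∀ x : M, TangentSpace 𝓘(ℝ, E) x → Prop) (γ : ℝ → M) (a b : ℝ) : Prop :=
  a < b ∧ ContinuousOn γ (Icc a b) ∧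
  ∃ (n : ℕ) (t : ℕ → ℝ), t 0 = a ∧ t n = b ∧ ∀ i < n, t i < t (i + 1) ∧
    ContMDiffOn 𝓘(ℝ, ℝ) 𝓘(ℝ, E) 1 γ (Icc (t i) (t (i + 1))) ∧
    ∀ s ∈ Icc (t i) (t (i + 1)),
      P (γ s) (mfderivWithin 𝓘(ℝ, ℝ) 𝓘(ℝ, E) γ (Icc (t i) (t (i + 1))) s (1 : ℝ))

/-- Future-directed timelike curves, parametrized on `[a, b]`. -/
def IsTimelikeCurve (g : LorentzianMetric E M) (τ : TimeOrientation g)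
    (γ : ℝ → M) (a b : ℝ) : Prop :=
  IsPiecewiseC1With (IsFutureTimelike g τ) γ a b

/-- Future-directed causal curves, parametrized on `[a, b]`. -/
def IsCausalCurve (g : LorentzianMetric E M) (τ : TimeOrientation g)
    (γ : ℝ → M) (a b : ℝ) : Prop :=
  IsPiecewiseC1With (IsFutureCausal g τ) γ a b

/-- The Lorentzian length `∫ √(-g(γ', γ'))` of a causal curve on `[a, b]` (the velocity exists
outside the finitely many break points, which do not contribute to the integral). -/
def length (g : LorentzianMetric E M) (γ : ℝ → M) (a b : ℝ) : ℝ≥0∞ :=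
  ∫⁻ s in Icc a b, ENNReal.ofReal (Real.sqrt
    (-(g.val (γ s) (mfderiv 𝓘(ℝ, ℝ) 𝓘(ℝ, E) γ s (1 : ℝ))
      (mfderiv 𝓘(ℝ, ℝ) 𝓘(ℝ, E) γ s (1 : ℝ)))))

/-- The chronological relation `p ≪ q`. -/
def Chron (g : LorentzianMetric E M) (τ : TimeOrientation g) (p q : M) : Prop :=
  ∃ (γ : ℝ → M) (a b : ℝ), IsTimelikeCurve g τ γ a b ∧ γ a = p ∧ γ b = q

/-- The chronological future `I⁺(p)`. -/
def chronFuture (g : LorentzianMetric E M) (τ : TimeOrientation g) (p : M) : Set M :=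
  {q | Chron g τ p q}

/-- The chronological past `I⁻(p)`. -/
def chronPast (g : LorentzianMetric E M) (τ : TimeOrientation g) (p : M) : Set M :=
  {q | Chron g τ q p}

/-- The Lorentzian distance: the supremum of the lengths of the future-directed causal curves from
`p` to `q`, with value `0` if there are none. -/
def dist (g : LorentzianMetric E M) (τ : TimeOrientation g) (p q : M) : ℝ≥0∞ :=
  sSup {l | ∃ (γ : ℝ → M) (a b : ℝ), IsCausalCurve g τ γ a b ∧ γ a = p ∧ γ b = q ∧
    l = length g γ a b}

/-- A set-valued map `F` is outer continuous at `x` if every compact set disjoint from the closure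
of `F x` is disjoint from the closure of `F y` for all `y` near `x`. -/
def OuterContinuousAt (F : M → Set M) (x : M) : Prop :=
  ∀ K : Set M, IsCompact K → Disjoint K (closure (F x)) →
    ∀ᶠ y in 𝓝 x, Disjoint K (closure (F y))

/-- The spacetime is distinguishing: both future and past distinguishing. -/
def Distinguishing (g : LorentzianMetric E M) (τ : TimeOrientation g) : Prop :=
  (∀ p q : M, chronFuture g τ p = chronFuture g τ q → p = q) ∧
  (∀ p q : M, chronPast g τ p = chronPast g τ q → p = q)

/-- The spacetime is causally continuous: it is distinguishing and the set-valued maps `I⁺` and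
`I⁻` are outer continuous. -/
def CausallyContinuous (g : LorentzianMetric E M) (τ : TimeOrientation g) : Prop :=
  Distinguishing g τ ∧
  (∀ x : M, OuterContinuousAt (chronFuture g τ) x) ∧
  (∀ x : M, OuterContinuousAt (chronPast g τ) x)

/-- `d_p = d_q` and `d^p = d^q` imply `p = q`. -/
def WeaklyDDistinguishing (g : LorentzianMetric E M) (τ : TimeOrientation g) : Prop :=
  ∀ p q : M, (∀ r, dist g τ p r = dist g τ q r) → (∀ r, dist g τ r p = dist g τ r q) → p = q

/-- `d^p ≤ d^q` implies `d_q ≤ d_p`. -/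
def FutureDReflecting (g : LorentzianMetric E M) (τ : TimeOrientation g) : Prop :=
  ∀ p q : M, (∀ r, dist g τ r p ≤ dist g τ r q) → ∀ r, dist g τ q r ≤ dist g τ p r

/-- `d_q ≤ d_p` implies `d^p ≤ d^q`. -/
def PastDReflecting (g : LorentzianMetric E M) (τ : TimeOrientation g) : Prop :=
  ∀ p q : M, (∀ r, dist g τ q r ≤ dist g τ p r) → ∀ r, dist g τ r p ≤ dist g τ r q

/-- Both future and past `d`-reflecting. -/
def DReflecting (g : LorentzianMetric E M) (τ : TimeOrientation g) : Prop :=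
  FutureDReflecting g τ ∧ PastDReflecting g τ

end Lorentz

end

/-!
The proof passes through the chronological relation alone. A causal curve of positive length can be
deformed to a timelike curve with the same end points (`IsPiecewise.chron_of_length_ne_zero`), so
`d(p, q) > 0` if and only if `p ≪ q` (`dist_ne_zero_iff`). Hence `d_q ≤ d_p` implies
`I⁺(q) ⊆ I⁺(p)`. The converse holds as well (`dist_le_of_chronFuture_subset`): on a causal curve
from `q` to `r`, the part before the curve enters `I⁺(q)` has length zero, and each later point lies
in `I⁺(q) ⊆ I⁺(p)`, so that the rest of the curve can be preceded by a timelike curve from `p`. With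
the time-reversed statement, `d`-reflectivity becomes reflectivity,
`I⁻(p) ⊆ I⁻(q) ↔ I⁺(q) ⊆ I⁺(p)`, and weak `d`-distinction says that `I⁺(p) = I⁺(q)` and
`I⁻(p) = I⁻(q)` together imply `p = q`.

Reflectivity is equivalent to the outer continuity of `I⁺` and `I⁻`
(`outerContinuous_iff_reflecting`). Both directions use only that `I^±` is open and transitive, that
every point lies in the closure of its future and of its past, and that consequently
`q ∈ closure (I⁺(p))` means `I⁺(q) ⊆ I⁺(p)`. In a reflecting spacetime each of `I⁺(p) = I⁺(q)` and
`I⁻(p) = I⁻(q)` implies the other, so weak distinction and distinction agree.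

The geometric input is local and needs no geodesics. In a chart the metric is a `C^1` matrix field,
and the future timelike vectors form an open set of pairs (point, velocity); this gives the openness
of `I⁺`. For push-up (`IsPiecewise.chron_of_chron`), a causal curve `c` on a short interval `[a, b]`
is replaced by `c - ε (exp (K (b - t)) - 1) T₀` with a constant timelike vector `T₀`. Since the
metric is Lipschitz, a large `K` makes the new curve timelike for all small `ε > 0`, and it ends at `c b`.
Statements about pasts follow from those about futures by reversing the time orientation.
-/

set_option linter.unusedSectionVars false

noncomputable section

namespace Lorentz

variable {E : Type*} [NormedAddCommGroup E] [NormedSpace ℝ E]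
  {M : Type*} [TopologicalSpace M] [ChartedSpace E M] [IsManifold 𝓘(ℝ, E) ∞ M]

/-! ### The metric and the time orientation in a chart -/

/-- The isomorphism from the tangent space at `x` to the model space given by the chart at `x₀`
(zero when `x` is outside the domain of that chart). -/
def toCoord (x₀ x : M) : TangentSpace 𝓘(ℝ, E) x →L[ℝ] E :=
  (trivializationAt E (TangentSpace 𝓘(ℝ, E)) x₀).continuousLinearMapAt ℝ x

/-- The inverse of `toCoord x₀ x` (zero when `x` is outside the domain of the chart at `x₀`). -/
def ofCoord (x₀ x : M) : E →L[ℝ] TangentSpace 𝓘(ℝ, E) x :=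
  (trivializationAt E (TangentSpace 𝓘(ℝ, E)) x₀).symmL ℝ x

/-- The metric in the chart at `x₀`. -/
def coordMetric (g : LorentzianMetric E M) (x₀ : M) (y : E) : E →L[ℝ] E →L[ℝ] ℝ :=
  let x := (extChartAt 𝓘(ℝ, E) x₀).symm y
  let A : E →L[ℝ] E := ofCoord x₀ x
  let B : E →L[ℝ] E →L[ℝ] ℝ := g.val x
  B.bilinearComp A A

/-- The time-orienting vector field in the chart at `x₀`. -/
def coordField {g : LorentzianMetric E M} (τ : TimeOrientation g) (x₀ : M) (y : E) : E :=
  let x := (extChartAt 𝓘(ℝ, E) x₀).symm y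
  toCoord x₀ x (τ.field x)

lemma coordMetric_apply (g : LorentzianMetric E M) (x₀ : M) (y v w : E) :
    coordMetric g x₀ y v w = g.val ((extChartAt 𝓘(ℝ, E) x₀).symm y)
      (ofCoord x₀ ((extChartAt 𝓘(ℝ, E) x₀).symm y) v)
      (ofCoord x₀ ((extChartAt 𝓘(ℝ, E) x₀).symm y) w) :=
  rfl

lemma toCoord_eq_mfderiv {x₀ x : M} (hx : x ∈ (chartAt E x₀).source) :
    toCoord x₀ x = mfderiv 𝓘(ℝ, E) 𝓘(ℝ, E) (extChartAt 𝓘(ℝ, E) x₀) x :=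
  TangentBundle.continuousLinearMapAt_trivializationAt hx

lemma mem_baseSet_of_mem_source {x₀ x : M} (hx : x ∈ (chartAt E x₀).source) :
    x ∈ (trivializationAt E (TangentSpace 𝓘(ℝ, E)) x₀).baseSet := by
  simpa using hx

lemma ofCoord_toCoord {x₀ x : M} (hx : x ∈ (chartAt E x₀).source) (v : TangentSpace 𝓘(ℝ, E) x) :
    ofCoord x₀ x (toCoord x₀ x v) = v :=
  Trivialization.symmL_continuousLinearMapAt _ (mem_baseSet_of_mem_source hx) v

lemma toCoord_ofCoord {x₀ x : M} (hx : x ∈ (chartAt E x₀).source) (v : E) :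
    toCoord x₀ x (ofCoord x₀ x v) = v :=
  Trivialization.continuousLinearMapAt_symmL _ (mem_baseSet_of_mem_source hx) v

lemma coordMetric_toCoord (g : LorentzianMetric E M) (x₀ : M) {x : M}
    (hx : x ∈ (chartAt E x₀).source) (v w : TangentSpace 𝓘(ℝ, E) x) :
    coordMetric g x₀ (extChartAt 𝓘(ℝ, E) x₀ x) (toCoord x₀ x v) (toCoord x₀ x w) =
      g.val x v w := by
  have h1 : (extChartAt 𝓘(ℝ, E) x₀).symm (extChartAt 𝓘(ℝ, E) x₀ x) = x :=
    (extChartAt 𝓘(ℝ, E) x₀).left_inv (by simpa using hx)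
  rw [coordMetric_apply, h1, ofCoord_toCoord hx, ofCoord_toCoord hx]

lemma coordField_extChartAt {g : LorentzianMetric E M} (τ : TimeOrientation g) (x₀ : M) {x : M}
    (hx : x ∈ (chartAt E x₀).source) :
    coordField τ x₀ (extChartAt 𝓘(ℝ, E) x₀ x) = toCoord x₀ x (τ.field x) := by
  have h1 : (extChartAt 𝓘(ℝ, E) x₀).symm (extChartAt 𝓘(ℝ, E) x₀ x) = x :=
    (extChartAt 𝓘(ℝ, E) x₀).left_inv (by simpa using hx)
  rw [coordField, h1]

lemma contMDiffOn_ofCoord (x₀ : M) (v : E) :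
    ContMDiffOn 𝓘(ℝ, E) (𝓘(ℝ, E).prod 𝓘(ℝ, E)) 1
      (fun x : M => TotalSpace.mk' E (E := TangentSpace 𝓘(ℝ, E)) x (ofCoord x₀ x v))
      (chartAt E x₀).source := by
  have h := (trivializationAt E (TangentSpace 𝓘(ℝ, E)) x₀).contMDiffOn_symm
    (IB := 𝓘(ℝ, E)) (n := 1)
  have h2 : ContMDiffOn 𝓘(ℝ, E) (𝓘(ℝ, E).prod 𝓘(ℝ, E)) 1 (fun x : M => (x, v))
      (chartAt E x₀).source := contMDiffOn_id.prodMk contMDiffOn_const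
  refine (h.comp h2 ?_).congr ?_
  · intro x hx
    rw [mem_preimage, Trivialization.mem_target]
    exact mem_baseSet_of_mem_source hx
  · intro x hx
    rw [Function.comp_apply, ← Trivialization.mk_symm _ (mem_baseSet_of_mem_source hx), ofCoord,
      Trivialization.symmL_apply]
    exact mem_baseSet_of_mem_source hx

lemma contMDiffOn_val_ofCoord (g : LorentzianMetric E M) (x₀ : M) (v w : E) :
    ContMDiffOn 𝓘(ℝ, E) 𝓘(ℝ) 1 (fun x : M => g.val x (ofCoord x₀ x v) (ofCoord x₀ x w))
      (chartAt E x₀).source := by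
  intro x hx
  have h1 : ContMDiffWithinAt 𝓘(ℝ, E) (𝓘(ℝ, E).prod 𝓘(ℝ, E →L[ℝ] E →L[ℝ] ℝ)) 1
    (fun x : M => TotalSpace.mk' (E →L[ℝ] E →L[ℝ] ℝ)
      (E := fun x : M => TangentSpace 𝓘(ℝ, E) x →L[ℝ] TangentSpace 𝓘(ℝ, E) x →L[ℝ] ℝ)
      x (g.val x)) (chartAt E x₀).source x :=
    (g.contMDiff.of_le one_le_two).contMDiffAt.contMDiffWithinAt
  have : ContMDiffWithinAt 𝓘(ℝ, E) (𝓘(ℝ, E).prod 𝓘(ℝ)) 1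
      (fun x : M ↦ TotalSpace.mk' ℝ (E := Bundle.Trivial M ℝ) x
        (g.val x (ofCoord x₀ x v) (ofCoord x₀ x w))) (chartAt E x₀).source x :=
    ContMDiffWithinAt.clm_bundle_apply₂ (F₁ := E) (F₂ := E) h1
      (contMDiffOn_ofCoord x₀ v x hx) (contMDiffOn_ofCoord x₀ w x hx)
  exact ((contMDiffWithinAt_totalSpace).1 this).2

lemma contDiffOn_coordMetric [FiniteDimensional ℝ E] (g : LorentzianMetric E M) (x₀ : M) :
    ContDiffOn ℝ 1 (coordMetric g x₀) (extChartAt 𝓘(ℝ, E) x₀).target := by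
  refine contDiffOn_clm_apply.2 fun v => contDiffOn_clm_apply.2 fun w => ?_
  rw [← contMDiffOn_iff_contDiffOn]
  have hφ := contMDiffOn_extChartAt_symm (I := 𝓘(ℝ, E)) (n := 1) x₀
  refine ((contMDiffOn_val_ofCoord g x₀ v w).comp hφ ?_)
  intro y hy
  simpa using (extChartAt 𝓘(ℝ, E) x₀).map_target hy

lemma continuousOn_coordField {g : LorentzianMetric E M} (τ : TimeOrientation g) (x₀ : M) :
    ContinuousOn (coordField τ x₀) (extChartAt 𝓘(ℝ, E) x₀).target := by
  set e := trivializationAt E (TangentSpace 𝓘(ℝ, E)) x₀ with he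
  have h1 : ContinuousOn (fun x : M => (e ⟨x, τ.field x⟩).2) (chartAt E x₀).source := by
    refine continuous_snd.comp_continuousOn (e.continuousOn.comp τ.continuous.continuousOn ?_)
    intro x hx
    rw [Trivialization.mem_source]
    exact mem_baseSet_of_mem_source hx
  refine (h1.comp (continuousOn_extChartAt_symm x₀) ?_).congr ?_
  · intro y hy
    simpa using (extChartAt 𝓘(ℝ, E) x₀).map_target hy
  · intro y hy
    have : (extChartAt 𝓘(ℝ, E) x₀).symm y ∈ e.baseSet :=
      mem_baseSet_of_mem_source (by simpa using (extChartAt 𝓘(ℝ, E) x₀).map_target hy)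
    simp only [coordField, Function.comp_apply, toCoord]
    rw [Trivialization.continuousLinearMapAt_apply_of_mem _ _ this]

/-! ### Piecewise `C^1` curves -/

/-- The velocity at time `s` of the curve `γ` on `[a, b]`, one-sided at the end points. -/
abbrev velWithin (γ : ℝ → M) (a b s : ℝ) : TangentSpace 𝓘(ℝ, E) (γ s) :=
  mfderivWithin 𝓘(ℝ, ℝ) 𝓘(ℝ, E) γ (Icc a b) s (1 : ℝ)

/-- A `C^1` curve on `[a, b]` whose velocity satisfies `P` at all times. -/
def C1Piece (P : ∀ x : M, TangentSpace 𝓘(ℝ, E) x → Prop) (γ : ℝ → M) (a b : ℝ) : Prop :=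
  a < b ∧ ContMDiffOn 𝓘(ℝ, ℝ) 𝓘(ℝ, E) 1 γ (Icc a b) ∧ ∀ s ∈ Icc a b, P (γ s) (velWithin γ a b s)

/-- Finite concatenations of `C^1` pieces. This is the form of `IsPiecewiseC1With` that supports
induction. -/
inductive IsPiecewise (P : ∀ x : M, TangentSpace 𝓘(ℝ, E) x → Prop) (γ : ℝ → M) : ℝ → ℝ → Prop
  | piece {a b : ℝ} : C1Piece P γ a b → IsPiecewise P γ a b
  | trans {a b c : ℝ} : IsPiecewise P γ a b → IsPiecewise P γ b c → IsPiecewise P γ a c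

section Curves

variable {P P' : ∀ x : M, TangentSpace 𝓘(ℝ, E) x → Prop} {γ γ' : ℝ → M} {a b c : ℝ}

lemma C1Piece.mono (h : C1Piece P γ a b) (hP : ∀ x v, P x v → P' x v) : C1Piece P' γ a b :=
  ⟨h.1, h.2.1, fun s hs => hP _ _ (h.2.2 s hs)⟩

lemma IsPiecewise.lt (h : IsPiecewise P γ a b) : a < b := by
  induction h with
  | piece h => exact h.1
  | trans _ _ h1 h2 => exact h1.trans h2

lemma IsPiecewise.mono (h : IsPiecewise P γ a b) (hP : ∀ x v, P x v → P' x v) :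
    IsPiecewise P' γ a b := by
  induction h with
  | piece h => exact .piece (h.mono hP)
  | trans _ _ h1 h2 => exact .trans h1 h2

lemma IsPiecewise.continuousOn (h : IsPiecewise P γ a b) : ContinuousOn γ (Icc a b) := by
  induction h with
  | piece h => exact h.2.1.continuousOn
  | trans h1 h2 i1 i2 =>
    rw [← Icc_union_Icc_eq_Icc h1.lt.le h2.lt.le]
    exact i1.union_of_isClosed i2 isClosed_Icc isClosed_Icc

lemma isPiecewiseC1With_iff : IsPiecewiseC1With P γ a b ↔ IsPiecewise P γ a b := by
  constructor
  · rintro ⟨hab, -, n, t, h0, hn, ht⟩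
    have key : ∀ k, k + 1 ≤ n → IsPiecewise P γ (t 0) (t (k + 1)) := by
      intro k
      induction k with
      | zero => exact fun hk => .piece (ht 0 (by omega))
      | succ k ih => exact fun hk => .trans (ih (by omega)) (.piece (ht (k + 1) (by omega)))
    cases n with
    | zero => exact absurd (h0.symm.trans hn) hab.ne
    | succ n => simpa [h0, hn] using key n le_rfl
  · intro h
    refine ⟨h.lt, h.continuousOn, ?_⟩
    induction h with
    | @piece a b h =>
      refine ⟨1, fun i => if i = 0 then a else b, by simp, by simp, fun i hi => ?_⟩
      obtain rfl : i = 0 := by omega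
      simpa only [if_true, zero_add, one_ne_zero, if_false] using! h
    | @trans a b c h1 h2 i1 i2 =>
      obtain ⟨n, t, ht0, htn, ht⟩ := i1
      obtain ⟨m, u, hu0, hum, hu⟩ := i2
      refine ⟨n + m, fun i => if i ≤ n then t i else u (i - n), by simpa using ht0, ?_, ?_⟩
      · rcases Nat.eq_zero_or_pos m with rfl | hm
        · simpa [htn] using hu0.symm.trans hum
        · simpa [hm.ne'] using hum
      · intro i hi
        rcases lt_or_ge i n with hin | hin
        · simpa [hin.le, Nat.succ_le_of_lt hin] using ht i hin
        · have e1 : (if i ≤ n then t i else u (i - n)) = u (i - n) := by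
            rcases hin.eq_or_lt with rfl | hlt
            · simp [htn, hu0]
            · simp [hlt]
          have e2 : (if i + 1 ≤ n then t (i + 1) else u (i + 1 - n)) = u (i - n + 1) := by
            rw [if_neg (by omega), Nat.sub_add_comm hin]
          simp only [e1, e2]
          exact hu (i - n) (by omega)

lemma velWithin_subset (h : ContMDiffOn 𝓘(ℝ, ℝ) 𝓘(ℝ, E) 1 γ (Icc a b)) {a' b' : ℝ} (hab : a' < b')
    (ha : a ≤ a') (hb : b' ≤ b) {s : ℝ} (hs : s ∈ Icc a' b') :
    velWithin (E := E) γ a' b' s = velWithin γ a b s := by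
  have hsub : Icc a' b' ⊆ Icc a b := Icc_subset_Icc ha hb
  rw [velWithin, mfderivWithin_subset hsub
    (uniqueMDiffWithinAt_iff_uniqueDiffWithinAt.2 (uniqueDiffOn_Icc hab s hs))
    ((h s (hsub hs)).mdifferentiableWithinAt one_ne_zero)]

lemma C1Piece.restrict (h : C1Piece P γ a b) {a' b' : ℝ} (hab : a' < b')
    (ha : a ≤ a') (hb : b' ≤ b) : C1Piece P γ a' b' := by
  have hsub : Icc a' b' ⊆ Icc a b := Icc_subset_Icc ha hb
  refine ⟨hab, h.2.1.mono hsub, fun s hs => ?_⟩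
  rw [velWithin_subset h.2.1 hab ha hb hs]
  exact h.2.2 s (hsub hs)

lemma IsPiecewise.restrict_left (h : IsPiecewise P γ a b) {s : ℝ} (hs : a ≤ s) (hsb : s < b) :
    IsPiecewise P γ s b := by
  induction h with
  | piece h => exact .piece (h.restrict hsb hs le_rfl)
  | @trans a b c h1 h2 i1 i2 =>
    rcases lt_or_ge s b with hlt | hge
    · exact .trans (i1 hs hlt) h2
    · exact i2 hge hsb

lemma IsPiecewise.restrict_right (h : IsPiecewise P γ a b) {s : ℝ} (hs : a < s) (hsb : s ≤ b) :
    IsPiecewise P γ a s := by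
  induction h with
  | piece h => exact .piece (h.restrict hs le_rfl hsb)
  | @trans a b c h1 h2 i1 i2 =>
    rcases lt_or_ge b s with hlt | hge
    · exact .trans h1 (i2 hlt hsb)
    · exact i1 hs hge

lemma C1Piece.congr (h : C1Piece P γ a b) (he : EqOn γ' γ (Icc a b)) : C1Piece P γ' a b := by
  refine ⟨h.1, h.2.1.congr he, fun s hs => ?_⟩
  have h1 : (mfderivWithin 𝓘(ℝ, ℝ) 𝓘(ℝ, E) γ' (Icc a b) s : ℝ →L[ℝ] E) =
      mfderivWithin 𝓘(ℝ, ℝ) 𝓘(ℝ, E) γ (Icc a b) s := mfderivWithin_congr he (he hs)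
  -- `P` depends on the base point, so the two base points are identified first
  have transport : ∀ (x y : M) (v w : E), x = y → v = w → P x v → P y w := by
    rintro x _ v _ rfl rfl hP
    exact hP
  exact transport _ _ _ _ (he hs).symm (DFunLike.congr_fun h1 (1 : ℝ)).symm (h.2.2 s hs)

lemma IsPiecewise.congr (h : IsPiecewise P γ a b) (he : EqOn γ' γ (Icc a b)) :
    IsPiecewise P γ' a b := by
  induction h with
  | piece h => exact .piece (h.congr he)
  | trans h1 h2 i1 i2 =>
    exact .trans (i1 (he.mono (Icc_subset_Icc_right h2.lt.le)))
      (i2 (he.mono (Icc_subset_Icc_left h1.lt.le)))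

/-- Affine reparametrization; `σ = -1` reverses the curve. -/
lemma C1Piece.comp_affine (h : C1Piece P γ a b) {σ k a' b' : ℝ} (hab : a' < b')
    (hm : MapsTo (fun t => σ * t + k) (Icc a' b') (Icc a b))
    (hP : ∀ x (v : TangentSpace 𝓘(ℝ, E) x), P x v → P' x (σ • v)) :
    C1Piece P' (fun t => γ (σ * t + k)) a' b' := by
  have hd : ContMDiff 𝓘(ℝ, ℝ) 𝓘(ℝ, ℝ) 1 (fun t : ℝ => σ * t + k) := by
    rw [contMDiff_iff_contDiff]
    fun_prop
  refine ⟨hab, h.2.1.comp hd.contMDiffOn hm, fun s hs => ?_⟩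
  have hu : UniqueMDiffWithinAt 𝓘(ℝ, ℝ) (Icc a' b') s :=
    uniqueMDiffWithinAt_iff_uniqueDiffWithinAt.2 (uniqueDiffOn_Icc hab s hs)
  have h1 : HasMFDerivWithinAt 𝓘(ℝ, ℝ) 𝓘(ℝ, ℝ) (fun t : ℝ => σ * t + k) (Icc a' b') s
      (ContinuousLinearMap.toSpanSingleton ℝ σ : ℝ →L[ℝ] ℝ) := by
    have : HasDerivAt (fun t : ℝ => σ * t + k) σ s := by
      simpa using ((hasDerivAt_id s).const_mul σ).add_const k
    exact this.hasFDerivAt.hasMFDerivAt.hasMFDerivWithinAt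
  have hm' : Icc a' b' ⊆ (fun t => σ * t + k) ⁻¹' Icc a b := hm
  have h2 := ((h.2.1 _ (hm hs)).mdifferentiableWithinAt one_ne_zero).hasMFDerivWithinAt
  have h3 := (h2.comp s h1 hm').mfderivWithin hu
  have h4 : velWithin (E := E) (fun t => γ (σ * t + k)) a' b' s =
      σ • velWithin γ a b (σ * s + k) := by
    have : velWithin (E := E) (fun t => γ (σ * t + k)) a' b' s =
        mfderivWithin 𝓘(ℝ, ℝ) 𝓘(ℝ, E) γ (Icc a b) (σ * s + k)
          ((ContinuousLinearMap.toSpanSingleton ℝ σ : ℝ →L[ℝ] ℝ) 1) :=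
      DFunLike.congr_fun h3 (1 : ℝ)
    have hL : ∀ L : ℝ →L[ℝ] E, L ((ContinuousLinearMap.toSpanSingleton ℝ σ : ℝ →L[ℝ] ℝ) 1) =
        σ • L 1 := fun L => by rw [← map_smul]; simp
    exact this.trans (hL _)
  rw [h4]
  exact hP _ _ (h.2.2 _ (hm hs))

lemma IsPiecewise.comp_add (h : IsPiecewise P γ a b) (k : ℝ) :
    IsPiecewise P (fun t => γ (t + k)) (a - k) (b - k) := by
  induction h with
  | piece h =>
    have := h.comp_affine (P' := P) (σ := 1) (k := k) (sub_lt_sub_right h.1 k)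
      (fun t ht => by constructor <;> simp only [one_mul] <;> linarith [ht.1, ht.2])
      (fun x v hv => by rwa [one_smul])
    simp only [one_mul] at this
    exact .piece this
  | trans _ _ i1 i2 => exact .trans i1 i2

lemma IsPiecewise.comp_neg (h : IsPiecewise P γ a b) (hP : ∀ x v, P x v → P' x (-v)) :
    IsPiecewise P' (fun t => γ (-t)) (-b) (-a) := by
  induction h with
  | piece h =>
    have := h.comp_affine (P' := P') (σ := -1) (k := 0) (neg_lt_neg h.1)
      (fun t ht => by constructor <;> simp only [neg_mul, one_mul] <;> linarith [ht.1, ht.2])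
      (fun x v hv => by rw [neg_one_smul]; exact hP x v hv)
    simp only [neg_mul, one_mul, add_zero] at this
    exact .piece this
  | trans _ _ i1 i2 => exact .trans i2 i1

/-- Concatenation: `γ'` on `[a, b]` is followed by `γ` on `[b, c]`. -/
lemma IsPiecewise.glue (h : IsPiecewise P γ' a b) (h' : IsPiecewise P γ b c) (he : γ' b = γ b) :
    IsPiecewise P (fun t => if t ≤ b then γ' t else γ t) a c := by
  refine .trans (h.congr fun t ht => if_pos ht.2) (h'.congr fun t ht => ?_)
  rcases ht.1.eq_or_lt with rfl | hlt
  · simp [he]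
  · exact if_neg hlt.not_ge

/-- A relation between times that is transitive and holds locally holds on the whole interval. -/
lemma interval_induction {Q : ℝ → ℝ → Prop} (hab : a < b)
    (htrans : ∀ s t u, Q s t → Q t u → Q s u)
    (hloc : ∀ x ∈ Icc a b, ∃ δ > 0, ∀ s t, a ≤ s → s < t → t ≤ b → x - δ < s → t < x + δ → Q s t) :
    Q a b := by
  choose! d hd hQ using hloc
  obtain ⟨δ, hδ, hL⟩ := lebesgue_number_lemma_of_metric
    (c := fun x : Icc a b => Metric.ball x.1 (d x.1)) isCompact_Icc (fun _ => Metric.isOpen_ball)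
    (fun x hx => mem_iUnion.2 ⟨⟨x, hx⟩, Metric.mem_ball_self (hd x hx)⟩)
  have base : ∀ s t, a ≤ s → s < t → t ≤ b → t - s ≤ δ / 2 → Q s t := by
    intro s t h1 h2 h3 h4
    obtain ⟨⟨x, hx⟩, hi⟩ := hL s ⟨h1, h2.le.trans h3⟩
    have hs := hi (Metric.mem_ball_self hδ)
    have ht : t ∈ Metric.ball s δ := by
      rw [Real.ball_eq_Ioo]; constructor <;> linarith
    replace ht := hi ht
    rw [Real.ball_eq_Ioo] at hs ht
    exact hQ x hx s t h1 h2 h3 hs.1 ht.2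
  have key : ∀ (n : ℕ) s t, a ≤ s → s < t → t ≤ b → t - s ≤ (n + 1) * (δ / 2) → Q s t := by
    intro n
    induction n with
    | zero => exact fun s t h1 h2 h3 h4 => base s t h1 h2 h3 (by simpa using h4)
    | succ n ih =>
      intro s t h1 h2 h3 h4
      push_cast at h4
      have hn : (0 : ℝ) ≤ n * (δ / 2) := by positivity
      by_cases h5 : t - s ≤ δ / 2
      · exact base s t h1 h2 h3 h5
      · exact htrans s (s + δ / 2) t (base _ _ h1 (by linarith) (by linarith) (by linarith))
          (ih _ _ (by linarith) (by linarith) h3 (by linarith))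
  obtain ⟨n, hn⟩ := exists_nat_gt ((b - a) / (δ / 2))
  rw [div_lt_iff₀ (by positivity)] at hn
  exact key n a b le_rfl hab le_rfl (by linarith)

/-! ### Curves in a chart -/

/-- Chain rule: the chart velocity of a curve is the derivative of its chart expression. -/
lemma toCoord_velWithin {x₀ : M} (hab : a < b) (h : ContMDiffOn 𝓘(ℝ, ℝ) 𝓘(ℝ, E) 1 γ (Icc a b))
    {s : ℝ} (hs : s ∈ Icc a b) (hx : γ s ∈ (chartAt E x₀).source) :
    toCoord x₀ (γ s) (velWithin γ a b s) =
      derivWithin (fun t => extChartAt 𝓘(ℝ, E) x₀ (γ t)) (Icc a b) s := by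
  have hu : UniqueMDiffWithinAt 𝓘(ℝ, ℝ) (Icc a b) s :=
    uniqueMDiffWithinAt_iff_uniqueDiffWithinAt.2 (uniqueDiffOn_Icc hab s hs)
  have h1 := mfderiv_comp_mfderivWithin (I'' := 𝓘(ℝ, E)) s (mdifferentiableAt_extChartAt hx)
    ((h s hs).mdifferentiableWithinAt one_ne_zero) hu
  rw [mfderivWithin_eq_fderivWithin] at h1
  rw [toCoord_eq_mfderiv hx, ← fderivWithin_derivWithin]
  exact (DFunLike.congr_fun h1 (1 : ℝ)).symm

lemma contDiffOn_chart {x₀ : M} (h : ContMDiffOn 𝓘(ℝ, ℝ) 𝓘(ℝ, E) 1 γ (Icc a b))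
    (hx : ∀ s ∈ Icc a b, γ s ∈ (chartAt E x₀).source) :
    ContDiffOn ℝ 1 (fun t => extChartAt 𝓘(ℝ, E) x₀ (γ t)) (Icc a b) := by
  rw [← contMDiffOn_iff_contDiffOn]
  exact (contMDiffOn_extChartAt (n := 1)).comp h hx

lemma contMDiffOn_chart_symm {x₀ : M} {c : ℝ → E} (h : ContDiffOn ℝ 1 c (Icc a b))
    (hx : ∀ s ∈ Icc a b, c s ∈ (extChartAt 𝓘(ℝ, E) x₀).target) :
    ContMDiffOn 𝓘(ℝ, ℝ) 𝓘(ℝ, E) 1 (fun t => (extChartAt 𝓘(ℝ, E) x₀).symm (c t)) (Icc a b) :=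
  (contMDiffOn_extChartAt_symm (n := 1) x₀).comp (contMDiffOn_iff_contDiffOn.2 h) hx

end Curves

/-! ### Lorentzian linear algebra -/

namespace LorentzianMetric

variable (g : LorentzianMetric E M) {x : M}

/-- A timelike vector is not orthogonal to a nonzero causal vector. -/
lemma val_ne_zero {u w : TangentSpace 𝓘(ℝ, E) x} (hu : g.val x u u < 0) (hw : w ≠ 0)
    (hww : g.val x w w ≤ 0) : g.val x u w ≠ 0 := by
  intro huw
  obtain ⟨v, hv, hpos⟩ := g.signature x
  set α := g.val x v u with hα
  set β := g.val x v w with hβ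
  -- a combination of `u` and `w` that is orthogonal to the negative vector `v` must vanish
  have hz : β • u - α • w = 0 := by
    by_contra hne
    have h1 := hpos (β • u - α • w) (by simp [← hα, ← hβ]; ring) hne
    have h2 : g.val x (β • u - α • w) (β • u - α • w) =
        β ^ 2 * g.val x u u + α ^ 2 * g.val x w w := by
      simp only [map_sub, map_smul, sub_apply, smul_apply,
        smul_eq_mul, huw, g.symm x w u]
      ring
    nlinarith [sq_nonneg α, sq_nonneg β, mul_nonneg (sq_nonneg α) (neg_nonneg.2 hww),
      mul_nonneg (sq_nonneg β) (neg_nonneg.2 hu.le)]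
  have hu0 : u ≠ 0 := by rintro rfl; simp at hu
  have hα0 : α ≠ 0 := fun h => (hpos u h hu0).not_gt hu
  have h3 : g.val x u (β • u - α • w) = 0 := by rw [hz, map_zero]
  simp only [map_sub, map_smul, smul_eq_mul, huw, mul_zero, sub_zero] at h3
  have hβ0 : β = 0 := (mul_eq_zero.1 h3).resolve_right hu.ne
  rw [hβ0, zero_smul, zero_sub, neg_eq_zero] at hz
  exact (smul_ne_zero hα0 hw) hz

/-- If `u` and `u'` are timelike in the same cone, then a causal vector that is in the cone of `u`
is in the cone of `u'`. -/
lemma val_neg_of_same_cone {u u' w : TangentSpace 𝓘(ℝ, E) x} (hu : g.val x u u < 0)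
    (hu' : g.val x u' u' < 0) (huu' : g.val x u u' < 0) (hw : w ≠ 0) (hww : g.val x w w ≤ 0)
    (huw : g.val x u w < 0) : g.val x u' w < 0 := by
  refine lt_of_le_of_ne ?_ (g.val_ne_zero hu' hw hww)
  by_contra! h
  set α := g.val x u' w with hα
  set β := g.val x u w with hβ
  -- a positive combination of `u` and `u'` is timelike; this one is orthogonal to `w`
  have h1 : g.val x (α • u - β • u') w = 0 := by
    simp [← hα, ← hβ]; ring
  refine g.val_ne_zero ?_ hw hww h1
  simp only [map_sub, map_smul, sub_apply, smul_apply,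
    smul_eq_mul, g.symm x u' u]
  have h2 : 0 < α * -β := mul_pos h (neg_pos.2 huw)
  nlinarith [mul_pos h2 (neg_pos.2 huu'), mul_pos (mul_pos h h) (neg_pos.2 hu),
    mul_pos (mul_pos (neg_pos.2 huw) (neg_pos.2 huw)) (neg_pos.2 hu')]

end LorentzianMetric

lemma IsFutureTimelike.isFutureCausal {g : LorentzianMetric E M} {τ : TimeOrientation g} {x : M}
    {v : TangentSpace 𝓘(ℝ, E) x} (h : IsFutureTimelike g τ x v) : IsFutureCausal g τ x v := by
  refine ⟨?_, h.1.le, h.2⟩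
  rintro rfl
  simpa using h.1

/-! ### The future cones in a chart -/

/-- The future timelike vectors in the chart at `x₀`, as a set of pairs (point, velocity). -/
def coordCone (g : LorentzianMetric E M) (τ : TimeOrientation g) (x₀ : M) : Set (E × E) :=
  {p | p.1 ∈ (extChartAt 𝓘(ℝ, E) x₀).target ∧ coordMetric g x₀ p.1 p.2 p.2 < 0 ∧
    coordMetric g x₀ p.1 (coordField τ x₀ p.1) p.2 < 0}

section Cone

variable {g : LorentzianMetric E M} {τ : TimeOrientation g} {x₀ : M}

lemma toCoord_mem_coordCone {x : M} (hx : x ∈ (chartAt E x₀).source)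
    {v : TangentSpace 𝓘(ℝ, E) x} :
    (extChartAt 𝓘(ℝ, E) x₀ x, toCoord x₀ x v) ∈ coordCone g τ x₀ ↔ IsFutureTimelike g τ x v := by
  have h1 : extChartAt 𝓘(ℝ, E) x₀ x ∈ (extChartAt 𝓘(ℝ, E) x₀).target :=
    (extChartAt 𝓘(ℝ, E) x₀).map_source (by simpa using hx)
  simp only [coordCone, mem_ofPred_eq, h1, true_and, coordField_extChartAt τ x₀ hx,
    coordMetric_toCoord g x₀ hx, IsFutureTimelike]

/-- A strict inequality between continuous functions on `W × F` is an open condition. -/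
lemma isOpen_setOf_lt_of_continuousOn {X Y : Type*} [TopologicalSpace X] [TopologicalSpace Y]
    {W : Set X} (hW : IsOpen W) {f : X × Y → ℝ} (hf : ContinuousOn f (W ×ˢ univ)) (k : ℝ) :
    IsOpen {p : X × Y | p.1 ∈ W ∧ f p < k} := by
  have := hf.isOpen_inter_preimage (hW.prod isOpen_univ) (isOpen_Iio (a := k))
  convert! this using 1
  ext p
  simp

lemma continuousOn_bilin {X F : Type*} [TopologicalSpace X] [NormedAddCommGroup F]
    [NormedSpace ℝ F] {W : Set X} {G : X → F →L[ℝ] F →L[ℝ] ℝ} {u v : X → F}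
    (hG : ContinuousOn G W) (hu : ContinuousOn u W) (hv : ContinuousOn v W) :
    ContinuousOn (fun x => G x (u x) (v x)) W :=
  (hG.clm_apply hu).clm_apply hv

lemma isOpen_coordCone [FiniteDimensional ℝ E] : IsOpen (coordCone g τ x₀) := by
  have hG : ContinuousOn (fun p : E × E => coordMetric g x₀ p.1)
      ((extChartAt 𝓘(ℝ, E) x₀).target ×ˢ univ) :=
    (contDiffOn_coordMetric g x₀).continuousOn.comp continuousOn_fst fun p hp => hp.1
  have hT : ContinuousOn (fun p : E × E => coordField τ x₀ p.1)
      ((extChartAt 𝓘(ℝ, E) x₀).target ×ˢ univ) :=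
    (continuousOn_coordField τ x₀).comp continuousOn_fst fun p hp => hp.1
  have h1 := isOpen_setOf_lt_of_continuousOn (isOpen_extChartAt_target (I := 𝓘(ℝ, E)) x₀)
    (continuousOn_bilin hG continuousOn_snd continuousOn_snd) 0
  have h2 := isOpen_setOf_lt_of_continuousOn (isOpen_extChartAt_target (I := 𝓘(ℝ, E)) x₀)
    (continuousOn_bilin hG hT continuousOn_snd) 0
  convert! h1.inter h2 using 1
  ext p
  simp only [coordCone, mem_inter_iff, mem_ofPred_eq]
  tauto

lemma C1Piece.mem_coordCone {γ : ℝ → M} {a b s : ℝ} (h : C1Piece (IsFutureTimelike g τ) γ a b)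
    (hs : s ∈ Icc a b) (hx : γ s ∈ (chartAt E x₀).source) :
    (extChartAt 𝓘(ℝ, E) x₀ (γ s),
      derivWithin (fun t => extChartAt 𝓘(ℝ, E) x₀ (γ t)) (Icc a b) s) ∈ coordCone g τ x₀ := by
  rw [← toCoord_velWithin h.1 h.2.1 hs hx, toCoord_mem_coordCone hx]
  exact h.2.2 s hs

lemma c1Piece_of_mem_coordCone {c c' : ℝ → E} {a b : ℝ} (hab : a < b)
    (hc : ContDiffOn ℝ 1 c (Icc a b)) (hc' : ∀ s ∈ Icc a b, HasDerivWithinAt c (c' s) (Icc a b) s)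
    (h : ∀ s ∈ Icc a b, (c s, c' s) ∈ coordCone g τ x₀) :
    C1Piece (IsFutureTimelike g τ) (fun t => (extChartAt 𝓘(ℝ, E) x₀).symm (c t)) a b := by
  have ht : ∀ s ∈ Icc a b, c s ∈ (extChartAt 𝓘(ℝ, E) x₀).target := fun s hs => (h s hs).1
  have hm := contMDiffOn_chart_symm hc ht
  refine ⟨hab, hm, fun s hs => ?_⟩
  have hx : (extChartAt 𝓘(ℝ, E) x₀).symm (c s) ∈ (chartAt E x₀).source := by
    simpa using (extChartAt 𝓘(ℝ, E) x₀).map_target (ht s hs)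
  rw [← toCoord_mem_coordCone hx, toCoord_velWithin hab hm hs hx,
    (extChartAt 𝓘(ℝ, E) x₀).right_inv (ht s hs)]
  rw [derivWithin_congr (f := c) (fun t h' => (extChartAt 𝓘(ℝ, E) x₀).right_inv (ht t h'))
    ((extChartAt 𝓘(ℝ, E) x₀).right_inv (ht s hs)),
    (hc' s hs).derivWithin (uniqueDiffOn_Icc hab s hs)]
  exact h s hs

/-- Tube lemma over a compact interval. -/
lemma eventually_forall_Icc_mem {Z Y : Type*} [TopologicalSpace Z] [TopologicalSpace Y] {O : Set Y}
    (hO : IsOpen O) {H : Z → ℝ → Y} {a b : ℝ} {z₀ : Z}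
    (hH : ContinuousOn (fun p : Z × ℝ => H p.1 p.2) (univ ×ˢ Icc a b))
    (h₀ : ∀ r ∈ Icc a b, H z₀ r ∈ O) : ∀ᶠ z in 𝓝 z₀, ∀ r ∈ Icc a b, H z r ∈ O := by
  have hc : Continuous (fun p : Z × Icc a b => H p.1 p.2) :=
    hH.comp_continuous (f := fun p : Z × Icc a b => (p.1, (p.2 : ℝ))) (by fun_prop)
      (fun p => ⟨mem_univ _, p.2.2⟩)
  have := (isCompact_univ (X := Icc a b)).eventually_forall_of_forall_eventually (x₀ := z₀)
    (P := fun z r => H z r ∈ O) (fun r _ => hc.continuousAt.eventually_mem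
      (hO.mem_nhds (h₀ r r.2)))
  filter_upwards [this] with z hz r hr using hz ⟨r, hr⟩ (mem_univ _)

/-- The ending point of a short timelike curve can be moved freely in a neighborhood. -/
lemma C1Piece.eventually_chron [FiniteDimensional ℝ E] {γ : ℝ → M} {a b : ℝ}
    (h : C1Piece (IsFutureTimelike g τ) γ a b) (hx : ∀ s ∈ Icc a b, γ s ∈ (chartAt E x₀).source) :
    ∀ᶠ q in 𝓝 (γ b), Chron g τ (γ a) q := by
  set φ := extChartAt 𝓘(ℝ, E) x₀ with hφ
  set c : ℝ → E := fun t => φ (γ t) with hc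
  have hab := h.1
  have hcd : ContDiffOn ℝ 1 c (Icc a b) := contDiffOn_chart h.2.1 hx
  have hcc := hcd.continuousOn
  have hc' := ((contDiffOn_one_iff_derivWithin (uniqueDiffOn_Icc hab)).1 hcd).2
  have hfst : ∀ {f : ℝ → E}, ContinuousOn f (Icc a b) →
      ContinuousOn (fun p : E × ℝ => f p.2) (univ ×ˢ Icc a b) :=
    fun hf => hf.comp continuousOn_snd fun p hp => hp.2
  have key : ∀ᶠ z in 𝓝 (0 : E), ∀ r ∈ Icc a b,
      (c r + ((r - a) / (b - a)) • z, derivWithin c (Icc a b) r + (1 / (b - a)) • z) ∈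
        coordCone g τ x₀ := by
    refine eventually_forall_Icc_mem isOpen_coordCone ?_ ?_
    · exact ((hfst hcc).add (by fun_prop)).prodMk ((hfst hc').add (by fun_prop))
    · intro r hr
      simp only [smul_zero, add_zero]
      exact h.mem_coordCone hr (hx r hr)
  have hb : γ b ∈ (chartAt E x₀).source := hx b (right_mem_Icc.2 hab.le)
  have hlim : Filter.Tendsto (fun q => φ q - φ (γ b)) (𝓝 (γ b)) (𝓝 0) := by
    have : ContinuousAt φ (γ b) := continuousAt_extChartAt' (by simpa using hb)
    simpa using this.tendsto.sub_const (φ (γ b))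
  filter_upwards [hlim.eventually key, (chartAt E x₀).open_source.mem_nhds hb] with q hq hqs
  refine ⟨fun t => φ.symm (c t + ((t - a) / (b - a)) • (φ q - φ (γ b))), a, b,
    isPiecewiseC1With_iff.2 (.piece (c1Piece_of_mem_coordCone hab ?_ ?_ hq)), ?_, ?_⟩
  · exact hcd.add (by fun_prop)
  · intro s hs
    refine ((hcd.differentiableOn one_ne_zero) s hs).hasDerivWithinAt.add ?_
    have : HasDerivAt (fun t : ℝ => (t - a) / (b - a)) (1 / (b - a)) s :=
      ((hasDerivAt_id s).sub_const a).div_const _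
    exact (this.smul_const _).hasDerivWithinAt
  · simp only [sub_self, zero_div, zero_smul, add_zero, hc]
    exact φ.left_inv (by simpa [hφ] using hx a (left_mem_Icc.2 hab.le))
  · have : b - a ≠ 0 := (sub_pos.2 hab).ne'
    simp only [div_self this, one_smul, hc, add_sub_cancel]
    exact φ.left_inv (by simpa [hφ] using hqs)

lemma exists_pos_forall_mem_of_mem_nhds {X : Type*} [TopologicalSpace X] {γ : ℝ → X} {s : Set ℝ}
    (h : ContinuousOn γ s) {x : ℝ} (hx : x ∈ s) {W : Set X} (hW : W ∈ 𝓝 (γ x)) :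
    ∃ δ > 0, ∀ r ∈ s, x - δ < r → r < x + δ → γ r ∈ W := by
  obtain ⟨δ, hδ, hb⟩ := Metric.mem_nhdsWithin_iff.1 ((h x hx) hW)
  refine ⟨δ, hδ, fun r hr h1 h2 => hb ⟨?_, hr⟩⟩
  rw [Real.ball_eq_Ioo]
  exact ⟨h1, h2⟩

end Cone

/-! ### The chronological relation -/

lemma TimeOrientation.continuous_neg_field {g : LorentzianMetric E M} (τ : TimeOrientation g) :
    Continuous (fun x : M => (⟨x, -τ.field x⟩ : TangentBundle 𝓘(ℝ, E) M)) := by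
  have h : ContMDiff 𝓘(ℝ, E) (𝓘(ℝ, E).prod 𝓘(ℝ, E)) 0
      (fun x : M => (⟨x, τ.field x⟩ : TangentBundle 𝓘(ℝ, E) M)) :=
    contMDiff_zero_iff.2 τ.continuous
  exact contMDiff_zero_iff.1 h.neg_section

/-- The opposite time orientation. -/
def TimeOrientation.reverse {g : LorentzianMetric E M} (τ : TimeOrientation g) :
    TimeOrientation g where
  field x := -τ.field x
  timelike x := by simpa using τ.timelike x
  continuous := τ.continuous_neg_field

section Chronology

variable {g : LorentzianMetric E M} {τ : TimeOrientation g} {p q r : M} {γ : ℝ → M} {a b : ℝ}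

lemma TimeOrientation.reverse_reverse : τ.reverse.reverse = τ := by
  simp [TimeOrientation.reverse]

lemma IsFutureTimelike.reverse_neg {x : M} {v : TangentSpace 𝓘(ℝ, E) x}
    (h : IsFutureTimelike g τ x v) : IsFutureTimelike g τ.reverse x (-v) := by
  simpa [IsFutureTimelike, TimeOrientation.reverse] using h

lemma IsFutureCausal.reverse_neg {x : M} {v : TangentSpace 𝓘(ℝ, E) x}
    (h : IsFutureCausal g τ x v) : IsFutureCausal g τ.reverse x (-v) := by
  simpa [IsFutureCausal, TimeOrientation.reverse] using h

lemma chron_iff : Chron g τ p q ↔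
    ∃ γ a b, IsPiecewise (IsFutureTimelike g τ) γ a b ∧ γ a = p ∧ γ b = q := by
  simp only [Chron, IsTimelikeCurve, isPiecewiseC1With_iff]

lemma IsPiecewise.chron (h : IsPiecewise (IsFutureTimelike g τ) γ a b) :
    Chron g τ (γ a) (γ b) :=
  chron_iff.2 ⟨γ, a, b, h, rfl, rfl⟩

lemma Chron.reverse (h : Chron g τ p q) : Chron g τ.reverse q p := by
  obtain ⟨γ, a, b, hγ, rfl, rfl⟩ := chron_iff.1 h
  simpa using (hγ.comp_neg (P' := IsFutureTimelike g τ.reverse)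
    fun _ _ hv => hv.reverse_neg).chron

lemma chron_reverse_iff : Chron g τ.reverse q p ↔ Chron g τ p q :=
  ⟨fun h => by simpa only [TimeOrientation.reverse_reverse] using h.reverse, Chron.reverse⟩

lemma chronFuture_reverse : chronFuture g τ.reverse p = chronPast g τ p := by
  ext q; exact chron_reverse_iff

lemma chronPast_reverse : chronPast g τ.reverse p = chronFuture g τ p := by
  ext q; exact chron_reverse_iff

/-- If two piecewise curves meet, the first can be reparametrized so as to be followed by the
second. -/
lemma IsPiecewise.exists_glue {P : ∀ x : M, TangentSpace 𝓘(ℝ, E) x → Prop} {γ' : ℝ → M}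
    {a' b' : ℝ} (h' : IsPiecewise P γ' a' b') (h : IsPiecewise P γ a b) (he : γ' b' = γ a) :
    ∃ (η : ℝ → M) (c : ℝ), c < a ∧ IsPiecewise P η c b ∧ η c = γ' a' ∧ EqOn η γ (Ioc a b) ∧
      η b = γ b := by
  have h1 := h'.comp_add (b' - a)
  rw [show b' - (b' - a) = a by ring] at h1
  refine ⟨_, _, h1.lt, h1.glue h (by simpa using he), ?_, ?_, ?_⟩
  · rw [if_pos h1.lt.le]; congr 1; ring
  · exact fun t ht => if_neg ht.1.not_ge
  · exact if_neg h.lt.not_ge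

lemma Chron.trans (h : Chron g τ p q) (h' : Chron g τ q r) : Chron g τ p r := by
  obtain ⟨γ, a, b, hγ, rfl, rfl⟩ := chron_iff.1 h
  obtain ⟨γ', a', b', hγ', he, rfl⟩ := chron_iff.1 h'
  obtain ⟨η, c, -, hη, e1, -, e2⟩ := hγ.exists_glue hγ' he.symm
  rw [← e1, ← e2]
  exact hη.chron

lemma IsPiecewise.exists_last_piece {P : ∀ x : M, TangentSpace 𝓘(ℝ, E) x → Prop}
    (h : IsPiecewise P γ a b) : ∃ s, a ≤ s ∧ C1Piece P γ s b := by
  induction h with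
  | piece h => exact ⟨_, le_rfl, h⟩
  | trans h1 h2 i1 i2 =>
    obtain ⟨s, hs, h⟩ := i2
    exact ⟨s, h1.lt.le.trans hs, h⟩

lemma isOpen_chronFuture [FiniteDimensional ℝ E] (p : M) : IsOpen (chronFuture g τ p) := by
  rw [isOpen_iff_mem_nhds]
  intro q hq
  obtain ⟨γ, a, b, h, rfl, rfl⟩ := chron_iff.1 hq
  obtain ⟨s, has, hs⟩ := h.exists_last_piece
  obtain ⟨δ, hδ, hW⟩ := exists_pos_forall_mem_of_mem_nhds hs.2.1.continuousOn
    (right_mem_Icc.2 hs.1.le) ((chartAt E (γ b)).open_source.mem_nhds (mem_chart_source E (γ b)))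
  obtain ⟨u, hu1, hu2⟩ : ∃ u, max s (b - δ) < u ∧ u < b :=
    exists_between (max_lt hs.1 (by linarith))
  have hsu := (le_max_left _ _).trans_lt hu1
  have hδu := (le_max_right _ _).trans_lt hu1
  have h1 := (hs.restrict hu2 hsu.le le_rfl).eventually_chron (x₀ := γ b)
    (fun t ht => hW t ⟨hsu.le.trans ht.1, ht.2⟩ (hδu.trans_le ht.1) (by linarith [ht.2]))
  filter_upwards [h1] with q hq
  exact (h.restrict_right (has.trans_lt hsu) hu2.le).chron.trans hq

lemma isOpen_chronPast [FiniteDimensional ℝ E] (p : M) : IsOpen (chronPast g τ p) := by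
  rw [← chronFuture_reverse]
  exact isOpen_chronFuture p

lemma mem_closure_chronFuture [FiniteDimensional ℝ E] (p : M) :
    p ∈ closure (chronFuture g τ p) := by
  set φ := extChartAt 𝓘(ℝ, E) p with hφ
  set T : E := coordField τ p (φ p) with hT
  have hp : p ∈ (chartAt E p).source := mem_chart_source E p
  have h0 : (φ p, T) ∈ coordCone g τ p := by
    rw [hT, coordField_extChartAt τ p hp, toCoord_mem_coordCone hp]
    exact ⟨τ.timelike p, τ.timelike p⟩
  have hc : Continuous fun t : ℝ => (φ p + t • T, T) := by fun_prop
  have h1 : ∀ᶠ t in 𝓝 (0 : ℝ), (φ p + t • T, T) ∈ coordCone g τ p :=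
    hc.continuousAt.eventually_mem (isOpen_coordCone.mem_nhds (by simpa using h0))
  obtain ⟨δ, hδ, hball⟩ := Metric.eventually_nhds_iff_ball.1 h1
  have h2 : ∀ t ∈ Ioo 0 δ, φ.symm (φ p + t • T) ∈ chronFuture g τ p := by
    intro t ht
    have hpiece : C1Piece (IsFutureTimelike g τ) (fun t : ℝ => φ.symm (φ p + t • T)) 0 t := by
      refine c1Piece_of_mem_coordCone (c' := fun _ => T) ht.1 (by fun_prop) ?_ ?_
      · intro s _
        have : HasDerivAt (fun t : ℝ => φ p + t • T) ((1 : ℝ) • T) s :=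
          ((hasDerivAt_id s).smul_const T).const_add _
        rw [one_smul] at this
        exact this.hasDerivWithinAt
      · intro s hs
        refine hball s ?_
        rw [Real.ball_eq_Ioo]
        constructor <;> linarith [hs.1, hs.2, ht.2]
    have := (IsPiecewise.piece hpiece).chron
    change Chron g τ p _
    simpa [hφ] using this
  have hlim : Filter.Tendsto (fun t : ℝ => φ.symm (φ p + t • T)) (𝓝[>] 0) (𝓝 p) := by
    have h3 : ContinuousAt φ.symm (φ p) := continuousAt_extChartAt_symm p
    have h4 : Filter.Tendsto (fun t : ℝ => φ p + t • T) (𝓝 0) (𝓝 (φ p)) := by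
      have : Continuous fun t : ℝ => φ p + t • T := by fun_prop
      simpa using this.tendsto 0
    have h5 := (h3.tendsto.comp h4).mono_left (nhdsWithin_le_nhds (s := Ioi 0))
    rwa [extChartAt_to_inv p] at h5
  refine mem_closure_of_tendsto hlim ?_
  filter_upwards [Ioo_mem_nhdsGT hδ] with t ht using h2 t ht

lemma mem_closure_chronPast [FiniteDimensional ℝ E] (p : M) : p ∈ closure (chronPast g τ p) := by
  rw [← chronFuture_reverse]
  exact mem_closure_chronFuture p

lemma Chron.exists_between [FiniteDimensional ℝ E] (h : Chron g τ p q) :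
    ∃ r, Chron g τ p r ∧ Chron g τ r q :=
  mem_closure_iff.1 (mem_closure_chronPast q) _ (isOpen_chronFuture p) h

end Chronology

/-! ### Push-up -/

set_option synthInstance.maxHeartbeats 200000 in
/-- A Lipschitz field of bilinear forms, evaluated at a fixed vector. -/
lemma bilin_apply_le_of_lipschitzOnWith {G : E → E →L[ℝ] E →L[ℝ] ℝ} {W : Set E} {L : NNReal}
    (hG : LipschitzOnWith L G W) {y z : E} (hy : y ∈ W) (hz : z ∈ W) (v : E) :
    G y v v ≤ G z v v + L * ‖y - z‖ * ‖v‖ * ‖v‖ := by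
  have h1 : ‖G y - G z‖ ≤ L * ‖y - z‖ := hG.norm_sub_le hy hz
  have h2 : G y v v - G z v v ≤ ‖G y - G z‖ * ‖v‖ * ‖v‖ := by
    have := (le_abs_self _).trans ((G y - G z).le_opNorm₂ v v)
    simpa using this
  have h3 : ‖G y - G z‖ * ‖v‖ * ‖v‖ ≤ L * ‖y - z‖ * ‖v‖ * ‖v‖ := by gcongr
  linarith

/-- Let `c` be a causal curve for a Lipschitz field of bilinear forms `G`, and let `T₀` be a
constant timelike field. Moving `c` a little along `-T₀`, by an amount that decreases exponentially to zero
at the final time, makes it timelike: the loss through the variation of `G` is dominated by the gain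
in velocity along `T₀`. -/
lemma exists_timelike_perturbation {G : E → E →L[ℝ] E →L[ℝ] ℝ} {T : E → E} {W : Set E}
    (hW : IsOpen W) {L : NNReal} (hG : LipschitzOnWith L G W) (hT : ContinuousOn T W)
    (hsymm : ∀ y ∈ W, ∀ v w, G y v w = G y w v) {T₀ : E} (hT₀ : ∀ y ∈ W, G y T₀ T₀ < 0)
    {a b : ℝ} (hab : a < b) {c c' : ℝ → E} (hc : ContinuousOn c (Icc a b))
    (hc' : ContinuousOn c' (Icc a b)) (hcW : ∀ r ∈ Icc a b, c r ∈ W)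
    (h1 : ∀ r ∈ Icc a b, G (c r) (c' r) (c' r) ≤ 0) (h2 : ∀ r ∈ Icc a b, G (c r) T₀ (c' r) < 0)
    (h3 : ∀ r ∈ Icc a b, G (c r) (T (c r)) (c' r) < 0) :
    ∃ f f' : ℝ → ℝ, ContDiff ℝ 1 f ∧ (∀ r, HasDerivAt f (f' r) r) ∧ f b = 0 ∧
      ∀ᶠ ε in 𝓝[>] (0 : ℝ), ∀ r ∈ Icc a b, c r + (ε * f r) • T₀ ∈ W ∧
        G (c r + (ε * f r) • T₀) (c' r + (ε * f' r) • T₀) (c' r + (ε * f' r) • T₀) < 0 ∧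
        G (c r + (ε * f r) • T₀) (T (c r + (ε * f r) • T₀)) (c' r + (ε * f' r) • T₀) < 0 := by
  have hne : (Icc a b).Nonempty := nonempty_Icc.2 hab.le
  obtain ⟨κ, hκ, h2κ⟩ : ∃ κ > 0, ∀ r ∈ Icc a b, G (c r) T₀ (c' r) < -κ := by
    have hcont : ContinuousOn (fun r => G (c r) T₀ (c' r)) (Icc a b) :=
      continuousOn_bilin (hG.continuousOn.comp hc hcW) continuousOn_const hc'
    obtain ⟨r₀, hr₀, hmax⟩ := isCompact_Icc.exists_isMaxOn hne hcont
    refine ⟨-G (c r₀) T₀ (c' r₀) / 2, by linarith [h2 r₀ hr₀], fun r hr => ?_⟩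
    have : G (c r) T₀ (c' r) ≤ G (c r₀) T₀ (c' r₀) := hmax hr
    linarith [h2 r₀ hr₀]
  obtain ⟨B, hB⟩ : ∃ B, ∀ r ∈ Icc a b, ‖c' r‖ ≤ B := isCompact_Icc.exists_bound_of_continuousOn hc'
  -- the exponential rate is such that `L * ‖T₀‖ * B ^ 2 < 2 * κ * K`
  set N : ℝ := L * ‖T₀‖ * B ^ 2 with hN
  have hN0 : 0 ≤ N := by positivity
  set K : ℝ := N / (2 * κ) + 1 with hK
  have hK0 : 0 < K := by positivity
  have hKN : N < 2 * κ * K := by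
    rw [hK, mul_add, mul_div_cancel₀ _ (by positivity)]; linarith
  set f : ℝ → ℝ := fun r => 1 - Real.exp (K * (b - r)) with hf
  set f' : ℝ → ℝ := fun r => K * Real.exp (K * (b - r)) with hf'
  have hfd : ∀ r, HasDerivAt f (f' r) r := by
    intro r
    have h : HasDerivAt (fun r : ℝ => K * (b - r)) (-K) r := by
      simpa using ((hasDerivAt_id r).const_sub b).const_mul K
    convert! h.exp.const_sub 1 using 1
    simp only [hf']; ring
  have hfc : Continuous f := by fun_prop
  have hfc' : Continuous f' := by fun_prop
  refine ⟨f, f', by fun_prop, hfd, by simp [hf], ?_⟩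
  have hO1 : IsOpen {p : E × E | p.1 ∈ W ∧ G p.1 T₀ p.2 < -κ} :=
    isOpen_setOf_lt_of_continuousOn hW (f := fun p : E × E => G p.1 T₀ p.2)
      (continuousOn_bilin (hG.continuousOn.comp continuousOn_fst fun p hp => hp.1)
        continuousOn_const continuousOn_snd) _
  have hO2 : IsOpen {p : E × E | p.1 ∈ W ∧ G p.1 (T p.1) p.2 < 0} :=
    isOpen_setOf_lt_of_continuousOn hW (f := fun p : E × E => G p.1 (T p.1) p.2)
      (continuousOn_bilin (hG.continuousOn.comp continuousOn_fst fun p hp => hp.1)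
        (hT.comp continuousOn_fst fun p hp => hp.1) continuousOn_snd) _
  have hsnd : ∀ {u : ℝ → E}, ContinuousOn u (Icc a b) →
      ContinuousOn (fun p : ℝ × ℝ => u p.2) (univ ×ˢ Icc a b) :=
    fun hu => hu.comp continuousOn_snd fun p hp => hp.2
  have hev1 : ∀ᶠ ε in 𝓝 (0 : ℝ), ∀ r ∈ Icc a b,
      (c r + (ε * f r) • T₀, c' r) ∈ {p : E × E | p.1 ∈ W ∧ G p.1 T₀ p.2 < -κ} := by
    refine eventually_forall_Icc_mem hO1 (((hsnd hc).add (by fun_prop)).prodMk (hsnd hc')) ?_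
    intro r hr
    simpa using ⟨hcW r hr, h2κ r hr⟩
  have hev2 : ∀ᶠ ε in 𝓝 (0 : ℝ), ∀ r ∈ Icc a b,
      (c r + (ε * f r) • T₀, c' r + (ε * f' r) • T₀) ∈
        {p : E × E | p.1 ∈ W ∧ G p.1 (T p.1) p.2 < 0} := by
    refine eventually_forall_Icc_mem hO2
      (((hsnd hc).add (by fun_prop)).prodMk ((hsnd hc').add (by fun_prop))) ?_
    intro r hr
    simpa using ⟨hcW r hr, h3 r hr⟩
  filter_upwards [nhdsWithin_le_nhds hev1, nhdsWithin_le_nhds hev2, self_mem_nhdsWithin]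
    with ε hε1 hε2 hε r hr
  obtain ⟨hyW, hy1⟩ := hε1 r hr
  obtain ⟨-, hy2⟩ := hε2 r hr
  refine ⟨hyW, ?_, hy2⟩
  replace hε : 0 < ε := hε
  set y := c r + (ε * f r) • T₀ with hy
  have hexp : 1 ≤ Real.exp (K * (b - r)) :=
    Real.one_le_exp (mul_nonneg hK0.le (sub_nonneg.2 hr.2))
  have hfr : f r ≤ 0 := by simp only [hf]; linarith
  have hf'r : f' r = K * (1 - f r) := by simp only [hf, hf']; ring
  have hf'pos : 0 < f' r := by rw [hf'r]; exact mul_pos hK0 (by linarith)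
  have hdist : ‖y - c r‖ = ε * -f r * ‖T₀‖ := by
    rw [hy, add_sub_cancel_left, norm_smul, Real.norm_eq_abs, abs_mul, abs_of_pos hε,
      abs_of_nonpos hfr]
  have hvar : G y (c' r) (c' r) ≤ N * (ε * -f r) := by
    have e1 := bilin_apply_le_of_lipschitzOnWith hG hyW (hcW r hr) (c' r)
    rw [hdist] at e1
    have e2 : L * (ε * -f r * ‖T₀‖) * ‖c' r‖ * ‖c' r‖ ≤ L * (ε * -f r * ‖T₀‖) * B * B := by
      have hB0 : 0 ≤ B := (norm_nonneg _).trans (hB r hr)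
      have h0 : 0 ≤ L * (ε * -f r * ‖T₀‖) := by
        have : 0 ≤ -f r := by linarith
        positivity
      gcongr
      · exact hB r hr
      · exact hB r hr
    have e3 : L * (ε * -f r * ‖T₀‖) * B * B = N * (ε * -f r) := by rw [hN]; ring
    linarith [h1 r hr]
  have hexpand : G y (c' r + (ε * f' r) • T₀) (c' r + (ε * f' r) • T₀) =
      G y (c' r) (c' r) + 2 * (ε * f' r) * G y T₀ (c' r) + (ε * f' r) ^ 2 * G y T₀ T₀ := by
    simp only [map_add, map_smul, add_apply, smul_apply, smul_eq_mul, hsymm y hyW (c' r) T₀]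
    ring
  rw [hexpand]
  have hεf : 0 < ε * f' r := mul_pos hε hf'pos
  have t2 : 2 * (ε * f' r) * G y T₀ (c' r) ≤ 2 * (ε * f' r) * -κ := by gcongr
  have t3 : (ε * f' r) ^ 2 * G y T₀ T₀ ≤ 0 :=
    mul_nonpos_of_nonneg_of_nonpos (sq_nonneg _) (hT₀ y hyW).le
  have t4 : N * (ε * -f r) ≤ 2 * κ * K * (ε * -f r) :=
    mul_le_mul_of_nonneg_right hKN.le (mul_nonneg hε.le (by linarith))
  have t5 : 2 * (ε * f' r) * -κ = - (2 * κ * K * ε) + - (2 * κ * K * (ε * -f r)) := by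
    rw [hf'r]; ring
  have t6 : 0 < 2 * κ * K * ε := by positivity
  linarith

lemma coordMetric_symm (g : LorentzianMetric E M) (x₀ : M) (y v w : E) :
    coordMetric g x₀ y v w = coordMetric g x₀ y w v := by
  rw [coordMetric_apply, coordMetric_apply, g.symm]

section PushUp

variable [FiniteDimensional ℝ E] {g : LorentzianMetric E M} {τ : TimeOrientation g} {p q r : M}
  {γ : ℝ → M} {a b : ℝ}

/-- Around each point there is a chart neighborhood with a constant vector field that is future
timelike and with respect to which the metric is Lipschitz. -/
lemma exists_timelike_nhds (g : LorentzianMetric E M) (τ : TimeOrientation g) (x₀ : M) :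
    ∃ (T₀ : E) (W : Set E) (L : NNReal), IsOpen W ∧ extChartAt 𝓘(ℝ, E) x₀ x₀ ∈ W ∧
      W ⊆ (extChartAt 𝓘(ℝ, E) x₀).target ∧ LipschitzOnWith L (coordMetric g x₀) W ∧
      ∀ y ∈ W, (y, T₀) ∈ coordCone g τ x₀ := by
  set φ := extChartAt 𝓘(ℝ, E) x₀ with hφ
  have hx : x₀ ∈ (chartAt E x₀).source := mem_chart_source E x₀
  have h0 : (φ x₀, coordField τ x₀ (φ x₀)) ∈ coordCone g τ x₀ := by
    rw [coordField_extChartAt τ x₀ hx, toCoord_mem_coordCone hx]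
    exact ⟨τ.timelike x₀, τ.timelike x₀⟩
  have hn : φ.target ∈ 𝓝 (φ x₀) := extChartAt_target_mem_nhds x₀
  obtain ⟨L, t, ht, hL⟩ := ((contDiffOn_coordMetric g x₀).contDiffAt hn).exists_lipschitzOnWith
  have hcone : ∀ᶠ y in 𝓝 (φ x₀), (y, coordField τ x₀ (φ x₀)) ∈ coordCone g τ x₀ := by
    have : Continuous fun y : E => (y, coordField τ x₀ (φ x₀)) := by fun_prop
    exact this.continuousAt.eventually_mem (isOpen_coordCone.mem_nhds h0)
  obtain ⟨W, hWs, hW, hxW⟩ := mem_nhds_iff.1 (Filter.inter_mem ht hcone)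
  exact ⟨_, W, L, hW, hxW, fun y hy => (hWs hy).2.1, hL.mono fun y hy => (hWs hy).1,
    fun y hy => (hWs hy).2⟩

/-- Push-up along one `C^1` piece: by `interval_induction` it suffices to treat a short piece inside
a chart, where `exists_timelike_perturbation` applies. -/
lemma C1Piece.chron_of_chron (h : C1Piece (IsFutureCausal g τ) γ a b)
    (hp : Chron g τ p (γ a)) : Chron g τ p (γ b) := by
  refine interval_induction (Q := fun s t => Chron g τ p (γ s) → Chron g τ p (γ t)) h.1
    (fun s t u h1 h2 h3 => h2 (h1 h3)) (fun x hx => ?_) hp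
  set x₀ := γ x with hx₀
  set φ := extChartAt 𝓘(ℝ, E) x₀ with hφ
  obtain ⟨T₀, W, L, hW, hxW, hWt, hL, hcone⟩ := exists_timelike_nhds g τ x₀
  have hV : φ.source ∩ φ ⁻¹' W ∈ 𝓝 x₀ :=
    Filter.inter_mem (extChartAt_source_mem_nhds x₀)
      ((continuousAt_extChartAt x₀).preimage_mem_nhds (hW.mem_nhds hxW))
  obtain ⟨δ, hδ, hδV⟩ := exists_pos_forall_mem_of_mem_nhds h.2.1.continuousOn hx hV
  refine ⟨δ, hδ, fun s t has hst htb hs ht hps => ?_⟩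
  have hpiece := h.restrict hst has htb
  have hmem : ∀ r ∈ Icc s t, γ r ∈ φ.source ∧ φ (γ r) ∈ W := fun r hr =>
    hδV r ⟨has.trans hr.1, hr.2.trans htb⟩ (hs.trans_le hr.1) (hr.2.trans_lt ht)
  have hsrc : ∀ r ∈ Icc s t, γ r ∈ (chartAt E x₀).source := fun r hr => by
    simpa [hφ] using (hmem r hr).1
  have hcd : ContDiffOn ℝ 1 (fun r => φ (γ r)) (Icc s t) := contDiffOn_chart hpiece.2.1 hsrc
  have hc' := ((contDiffOn_one_iff_derivWithin (uniqueDiffOn_Icc hst)).1 hcd).2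
  have hvel := fun r hr => toCoord_velWithin (x₀ := x₀) hst hpiece.2.1 hr (hsrc r hr)
  obtain ⟨f, f', hf, hf', hft, hev⟩ := exists_timelike_perturbation hW hL
    ((continuousOn_coordField τ x₀).mono hWt) (fun y _ => coordMetric_symm g x₀ y)
    (fun y hy => (hcone y hy).2.1) hst hcd.continuousOn hc' (fun r hr => (hmem r hr).2)
    (fun r hr => by
      rw [← hvel r hr, coordMetric_toCoord g x₀ (hsrc r hr)]
      exact (hpiece.2.2 r hr).2.1)
    (fun r hr => by
      obtain ⟨hv1, hv2, hv3⟩ := hpiece.2.2 r hr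
      obtain ⟨-, h4, h5⟩ := hcone _ (hmem r hr).2
      have e := toCoord_ofCoord (hsrc r hr) T₀
      rw [coordField_extChartAt τ x₀ (hsrc r hr), ← e, coordMetric_toCoord g x₀ (hsrc r hr)] at h5
      rw [← e, coordMetric_toCoord g x₀ (hsrc r hr)] at h4
      rw [← hvel r hr, ← e, coordMetric_toCoord g x₀ (hsrc r hr)]
      exact g.val_neg_of_same_cone (τ.timelike _) h4 h5 hv1 hv2 hv3)
    (fun r hr => by
      rw [← hvel r hr, coordField_extChartAt τ x₀ (hsrc r hr),
        coordMetric_toCoord g x₀ (hsrc r hr)]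
      exact (hpiece.2.2 r hr).2.2)
  -- the perturbed curve starts in the open set `I⁺(p)` once the perturbation is small
  have hs' : s ∈ Icc s t := left_mem_Icc.2 hst.le
  have hstart : ∀ᶠ ε in 𝓝 (0 : ℝ), φ.symm (φ (γ s) + (ε * f s) • T₀) ∈ chronFuture g τ p := by
    have h1 : ContinuousAt φ.symm (φ (γ s)) := continuousAt_extChartAt_symm' (hmem s hs').1
    have h2 : Filter.Tendsto (fun ε : ℝ => φ (γ s) + (ε * f s) • T₀) (𝓝 0) (𝓝 (φ (γ s))) := by
      have : Continuous fun ε : ℝ => φ (γ s) + (ε * f s) • T₀ := by fun_prop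
      have h3 := this.tendsto 0
      rwa [zero_mul, zero_smul, add_zero] at h3
    have h3 := h1.tendsto.comp h2
    rw [φ.left_inv (hmem s hs').1] at h3
    exact h3.eventually ((isOpen_chronFuture p).mem_nhds hps)
  obtain ⟨ε, hε1, hε2⟩ := (hev.and (nhdsWithin_le_nhds hstart)).exists
  have hnew : C1Piece (IsFutureTimelike g τ)
      (fun r => φ.symm (φ (γ r) + (ε * f r) • T₀)) s t := by
    refine c1Piece_of_mem_coordCone
      (c' := fun r => derivWithin (fun r => φ (γ r)) (Icc s t) r + (ε * f' r) • T₀) hst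
      (hcd.add (by fun_prop)) (fun r hr => ?_)
      (fun r hr => ⟨hWt (hε1 r hr).1, (hε1 r hr).2⟩)
    exact ((hcd.differentiableOn one_ne_zero) r hr).hasDerivWithinAt.add
      (((hf' r).const_mul ε).smul_const T₀).hasDerivWithinAt
  have hfin : Chron g τ p (φ.symm (φ (γ t) + (ε * f t) • T₀)) :=
    Chron.trans hε2 (IsPiecewise.piece hnew).chron
  rwa [hft, mul_zero, zero_smul, add_zero, φ.left_inv (hmem t (right_mem_Icc.2 hst.le)).1] at hfin

/-- Push-up: a timelike curve followed by a causal curve can be deformed to a timelike curve. -/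
lemma IsPiecewise.chron_of_chron (h : IsPiecewise (IsFutureCausal g τ) γ a b)
    (hp : Chron g τ p (γ a)) : Chron g τ p (γ b) := by
  induction h with
  | piece h => exact h.chron_of_chron hp
  | trans _ _ i1 i2 => exact i2 (i1 hp)

/-- Push-up: a causal curve followed by a timelike curve can be deformed to a timelike curve. -/
lemma IsPiecewise.chron_of_chron' (h : IsPiecewise (IsFutureCausal g τ) γ a b)
    (hq : Chron g τ (γ b) q) : Chron g τ (γ a) q := by
  have h1 := h.comp_neg (P' := IsFutureCausal g τ.reverse) fun _ _ hv => hv.reverse_neg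
  rw [← chron_reverse_iff]
  simpa using h1.chron_of_chron (p := q) (by simpa using hq.reverse)

end PushUp

/-! ### Length and Lorentzian distance -/

/-- The integrand of the Lorentzian length. -/
def speed (g : LorentzianMetric E M) (γ : ℝ → M) (s : ℝ) : ℝ≥0∞ :=
  ENNReal.ofReal (Real.sqrt (-(g.val (γ s) (mfderiv 𝓘(ℝ, ℝ) 𝓘(ℝ, E) γ s (1 : ℝ))
    (mfderiv 𝓘(ℝ, ℝ) 𝓘(ℝ, E) γ s (1 : ℝ)))))

section Length

variable {g : LorentzianMetric E M} {τ : TimeOrientation g} {p q r : M} {γ : ℝ → M} {a b c : ℝ}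

lemma length_eq_lintegral_speed : length g γ a b = ∫⁻ s in Icc a b, speed g γ s := rfl

lemma length_eq_lintegral_Ioo : length g γ a b = ∫⁻ s in Ioo a b, speed g γ s :=
  setLIntegral_congr Ioo_ae_eq_Icc.symm

lemma length_mono {a' b' : ℝ} (ha : a ≤ a') (hb : b' ≤ b) : length g γ a' b' ≤ length g γ a b :=
  lintegral_mono_set (Icc_subset_Icc ha hb)

lemma length_le_add (hab : a ≤ b) (hbc : b ≤ c) :
    length g γ a c ≤ length g γ a b + length g γ b c := by
  simp only [length_eq_lintegral_speed, ← Icc_union_Icc_eq_Icc hab hbc]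
  exact lintegral_union_le _ _ _

lemma speed_congr {η : ℝ → M} {s : ℝ} (h : η =ᶠ[𝓝 s] γ) : speed g η s = speed g γ s := by
  have transport : ∀ (x y : M) (v w : E), x = y → v = w →
      ENNReal.ofReal (Real.sqrt (-(g.val x v v))) =
        ENNReal.ofReal (Real.sqrt (-(g.val y w w))) := by
    rintro x _ v _ rfl rfl
    rfl
  have h1 : (mfderiv 𝓘(ℝ, ℝ) 𝓘(ℝ, E) η s : ℝ →L[ℝ] E) = mfderiv 𝓘(ℝ, ℝ) 𝓘(ℝ, E) γ s :=
    h.mfderiv_eq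
  exact transport _ _ _ _ h.eq_of_nhds (DFunLike.congr_fun h1 (1 : ℝ))

lemma speed_of_mem_Ioo {s : ℝ} (hs : s ∈ Ioo a b) :
    speed g γ s = ENNReal.ofReal (Real.sqrt (-(g.val (γ s) (velWithin γ a b s)
      (velWithin γ a b s)))) := by
  rw [speed, velWithin, mfderivWithin_of_mem_nhds (Icc_mem_nhds hs.1 hs.2)]

lemma mdifferentiableAt_comp_neg {s : ℝ} (h : MDifferentiableAt 𝓘(ℝ, ℝ) 𝓘(ℝ, E) γ (-s)) :
    MDifferentiableAt 𝓘(ℝ, ℝ) 𝓘(ℝ, E) (fun t => γ (-t)) s :=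
  MDifferentiableAt.comp s h differentiable_neg.differentiableAt.mdifferentiableAt

lemma speed_comp_neg (s : ℝ) : speed g (fun t => γ (-t)) s = speed g γ (-s) := by
  by_cases h : MDifferentiableAt 𝓘(ℝ, ℝ) 𝓘(ℝ, E) γ (-s)
  · have h1 : HasMFDerivAt 𝓘(ℝ, ℝ) 𝓘(ℝ, ℝ) (fun t : ℝ => -t) s
        (ContinuousLinearMap.toSpanSingleton ℝ (-1) : ℝ →L[ℝ] ℝ) :=
      (hasDerivAt_neg s).hasFDerivAt.hasMFDerivAt
    have h2 := (HasMFDerivAt.comp s h.hasMFDerivAt h1).mfderiv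
    have h3 : (mfderiv 𝓘(ℝ, ℝ) 𝓘(ℝ, E) (fun t => γ (-t)) s (1 : ℝ) : E) =
        -(mfderiv 𝓘(ℝ, ℝ) 𝓘(ℝ, E) γ (-s) (1 : ℝ) : E) := by
      have hL : ∀ L : ℝ →L[ℝ] E,
          L ((ContinuousLinearMap.toSpanSingleton ℝ (-1) : ℝ →L[ℝ] ℝ) 1) = -L 1 :=
        fun L => by rw [← map_neg]; simp
      exact (DFunLike.congr_fun h2 (1 : ℝ)).trans (hL _)
    have hval : ∀ (x : M) (v w : E), v = -w →
        g.val x v v = g.val x w w := by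
      rintro x _ w rfl
      have : ∀ w : TangentSpace 𝓘(ℝ, E) x, g.val x (-w) (-w) = g.val x w w := fun w => by simp
      exact this w
    exact congrArg (fun z => ENNReal.ofReal (Real.sqrt (-z))) (hval (γ (-s)) _ _ h3)
  · have h' : ¬ MDifferentiableAt 𝓘(ℝ, ℝ) 𝓘(ℝ, E) (fun t => γ (-t)) s := by
      rw [← neg_neg s]
      intro h'
      have := mdifferentiableAt_comp_neg h'
      simp only [neg_neg] at this
      exact h this
    -- both velocities have the junk value zero
    simp only [speed, mfderiv_zero_of_not_mdifferentiableAt h,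
      mfderiv_zero_of_not_mdifferentiableAt h']
    rfl

lemma length_comp_neg : length g (fun t => γ (-t)) (-b) (-a) = length g γ a b := by
  have h := (Measure.measurePreserving_neg (volume : Measure ℝ)).setLIntegral_comp_preimage_emb
    (MeasurableEquiv.neg ℝ).measurableEmbedding (speed g γ) (Icc a b)
  simp only [length_eq_lintegral_speed, speed_comp_neg]
  rw [← h]
  congr 2
  ext t
  simp only [mem_Icc, mem_preimage]
  constructor <;> rintro ⟨h1, h2⟩ <;> constructor <;> linarith

lemma dist_eq_sSup : dist g τ p q =
    sSup {l | ∃ (γ : ℝ → M) (a b : ℝ), IsPiecewise (IsFutureCausal g τ) γ a b ∧ γ a = p ∧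
      γ b = q ∧ l = length g γ a b} := by
  simp only [dist, IsCausalCurve, isPiecewiseC1With_iff]

lemma IsPiecewise.length_le_dist (h : IsPiecewise (IsFutureCausal g τ) γ a b) :
    length g γ a b ≤ dist g τ (γ a) (γ b) := by
  rw [dist_eq_sSup]
  exact le_sSup ⟨γ, a, b, h, rfl, rfl, rfl⟩

lemma dist_le_dist_reverse : dist g τ p q ≤ dist g τ.reverse q p := by
  rw [dist_eq_sSup]
  refine sSup_le ?_
  rintro _ ⟨γ, a, b, h, rfl, rfl, rfl⟩
  have h1 := h.comp_neg (P' := IsFutureCausal g τ.reverse) fun _ _ hv => hv.reverse_neg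
  simpa [length_comp_neg] using h1.length_le_dist

lemma dist_reverse : dist g τ.reverse q p = dist g τ p q := by
  refine le_antisymm ?_ dist_le_dist_reverse
  simpa only [TimeOrientation.reverse_reverse] using
    dist_le_dist_reverse (τ := τ.reverse) (p := q) (q := p)

variable [FiniteDimensional ℝ E]

/-- The velocity of a `C^1` curve stays timelike for a short time. -/
lemma C1Piece.exists_timelike_subpiece {P : ∀ x : M, TangentSpace 𝓘(ℝ, E) x → Prop}
    (h : C1Piece P γ a b) {s : ℝ} (hs : s ∈ Ico a b)
    (ht : IsFutureTimelike g τ (γ s) (velWithin γ a b s)) :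
    ∃ u, s < u ∧ u < b ∧ C1Piece (IsFutureTimelike g τ) γ s u := by
  set x₀ := γ s with hx₀
  obtain ⟨δ, hδ, hW⟩ := exists_pos_forall_mem_of_mem_nhds h.2.1.continuousOn ⟨hs.1, hs.2.le⟩
    ((chartAt E x₀).open_source.mem_nhds (mem_chart_source E x₀))
  obtain ⟨m, hsm, hm⟩ := exists_between (lt_min hs.2 (show s < s + δ by linarith))
  have hmb := hm.trans_le (min_le_left _ _)
  have hmδ := hm.trans_le (min_le_right _ _)
  have hpiece := h.restrict hsm hs.1 hmb.le
  have hsrc : ∀ r ∈ Icc s m, γ r ∈ (chartAt E x₀).source := fun r hr =>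
    hW r ⟨hs.1.trans hr.1, hr.2.trans hmb.le⟩ (by linarith [hr.1]) (by linarith [hr.2])
  have hcd := contDiffOn_chart hpiece.2.1 hsrc
  have hc' := ((contDiffOn_one_iff_derivWithin (uniqueDiffOn_Icc hsm)).1 hcd).2
  have hmem : ∀ r (hr : r ∈ Icc s m), (extChartAt 𝓘(ℝ, E) x₀ (γ r),
      derivWithin (fun t => extChartAt 𝓘(ℝ, E) x₀ (γ t)) (Icc s m) r) ∈ coordCone g τ x₀ ↔
        IsFutureTimelike g τ (γ r) (velWithin γ s m r) := by
    intro r hr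
    rw [← toCoord_velWithin hsm hpiece.2.1 hr (hsrc r hr), toCoord_mem_coordCone (hsrc r hr)]
  have hsI : s ∈ Icc s m := left_mem_Icc.2 hsm.le
  have h0 := (hmem s hsI).2 (by rw [velWithin_subset h.2.1 hsm hs.1 hmb.le hsI]; exact ht)
  obtain ⟨δ', hδ', hO⟩ := exists_pos_forall_mem_of_mem_nhds (hcd.continuousOn.prodMk hc') hsI
    (isOpen_coordCone.mem_nhds h0)
  obtain ⟨u, hsu, hu⟩ := exists_between (lt_min hsm (show s < s + δ' by linarith))
  have hum := hu.trans_le (min_le_left _ _)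
  have huδ := hu.trans_le (min_le_right _ _)
  refine ⟨u, hsu, hum.trans hmb, hsu, hpiece.2.1.mono (Icc_subset_Icc_right hum.le), ?_⟩
  intro r hr
  have hr' : r ∈ Icc s m := ⟨hr.1, hr.2.trans hum.le⟩
  rw [velWithin_subset hpiece.2.1 hsu le_rfl hum.le hr, ← hmem r hr']
  exact hO r hr' (by linarith [hr.1]) (by linarith [hr.2])

lemma C1Piece.chron_of_length_ne_zero (h : C1Piece (IsFutureCausal g τ) γ a b)
    (hl : length g γ a b ≠ 0) : Chron g τ (γ a) (γ b) := by
  obtain ⟨s, hs, ht⟩ : ∃ s ∈ Ioo a b, g.val (γ s) (velWithin γ a b s) (velWithin γ a b s) < 0 := by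
    by_contra! hcon
    refine hl ?_
    rw [length_eq_lintegral_Ioo, setLIntegral_congr_fun (g := fun _ => 0) measurableSet_Ioo,
      lintegral_zero]
    intro s hs
    have := hcon s hs
    simp only [speed_of_mem_Ioo hs]
    rw [Real.sqrt_eq_zero_of_nonpos (by linarith), ENNReal.ofReal_zero]
  obtain ⟨u, hsu, hub, hu⟩ := h.exists_timelike_subpiece (g := g) (τ := τ) ⟨hs.1.le, hs.2⟩
    ⟨ht, (h.2.2 s ⟨hs.1.le, hs.2.le⟩).2.2⟩
  have h1 := (IsPiecewise.piece (h.restrict hs.1 le_rfl hs.2.le)).chron_of_chron'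
    (IsPiecewise.piece hu).chron
  exact (IsPiecewise.piece (h.restrict hub (hs.1.le.trans hsu.le) le_rfl)).chron_of_chron h1

/-- A causal curve of positive length can be deformed to a timelike curve. -/
lemma IsPiecewise.chron_of_length_ne_zero (h : IsPiecewise (IsFutureCausal g τ) γ a b)
    (hl : length g γ a b ≠ 0) : Chron g τ (γ a) (γ b) := by
  induction h with
  | piece h => exact h.chron_of_length_ne_zero hl
  | @trans a b c h1 h2 i1 i2 =>
    by_cases hab : length g γ a b = 0
    · refine h1.chron_of_chron' (i2 fun hbc => hl (le_antisymm ?_ zero_le))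
      simpa [hab, hbc] using length_le_add (g := g) (γ := γ) h1.lt.le h2.lt.le
    · exact h2.chron_of_chron (i1 hab)

lemma C1Piece.length_ne_zero (h : C1Piece (IsFutureTimelike g τ) γ a b) :
    length g γ a b ≠ 0 := by
  set x₀ := γ a with hx₀
  have hab := h.1
  obtain ⟨δ, hδ, hW⟩ := exists_pos_forall_mem_of_mem_nhds h.2.1.continuousOn
    (left_mem_Icc.2 hab.le) ((chartAt E x₀).open_source.mem_nhds (mem_chart_source E x₀))
  obtain ⟨m, ham, hm⟩ := exists_between (lt_min hab (show a < a + δ by linarith))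
  have hmb := hm.trans_le (min_le_left _ _)
  have hmδ := hm.trans_le (min_le_right _ _)
  have hpiece := h.restrict ham le_rfl hmb.le
  have hsrc : ∀ r ∈ Icc a m, γ r ∈ (chartAt E x₀).source := fun r hr =>
    hW r ⟨hr.1, hr.2.trans hmb.le⟩ (by linarith [hr.1]) (by linarith [hr.2])
  have hcd := contDiffOn_chart hpiece.2.1 hsrc
  have hc' := ((contDiffOn_one_iff_derivWithin (uniqueDiffOn_Icc ham)).1 hcd).2
  have hmem := fun r hr => hpiece.mem_coordCone (x₀ := x₀) hr (hsrc r hr)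
  have hcont := continuousOn_bilin
    ((contDiffOn_coordMetric g x₀).continuousOn.comp hcd.continuousOn fun r hr => (hmem r hr).1)
    hc' hc'
  obtain ⟨r₀, hr₀, hmax⟩ := isCompact_Icc.exists_isMaxOn (nonempty_Icc.2 ham.le) hcont
  set κ := -coordMetric g x₀ (extChartAt 𝓘(ℝ, E) x₀ (γ r₀))
    (derivWithin (fun t => extChartAt 𝓘(ℝ, E) x₀ (γ t)) (Icc a m) r₀)
    (derivWithin (fun t => extChartAt 𝓘(ℝ, E) x₀ (γ t)) (Icc a m) r₀) with hκ
  have hκ0 : 0 < κ := neg_pos.2 (hmem r₀ hr₀).2.1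
  have hle : ∀ r ∈ Ioo a m, ENNReal.ofReal (Real.sqrt κ) ≤ speed g γ r := by
    intro r hr
    have hr' : r ∈ Icc a m := Ioo_subset_Icc_self hr
    rw [speed_of_mem_Ioo hr]
    refine ENNReal.ofReal_le_ofReal (Real.sqrt_le_sqrt ?_)
    rw [← coordMetric_toCoord g x₀ (hsrc r hr'), toCoord_velWithin ham hpiece.2.1 hr' (hsrc r hr'),
      hκ]
    exact neg_le_neg (hmax hr')
  have hpos : 0 < length g γ a m := by
    rw [length_eq_lintegral_Ioo]
    refine lt_of_lt_of_le ?_ (setLIntegral_mono' measurableSet_Ioo hle)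
    rw [setLIntegral_const, Real.volume_Ioo]
    exact ENNReal.mul_pos (by simpa using hκ0) (by simpa using ham)
  exact (hpos.trans_le (length_mono le_rfl hmb.le)).ne'

lemma IsPiecewise.length_ne_zero (h : IsPiecewise (IsFutureTimelike g τ) γ a b) :
    length g γ a b ≠ 0 := by
  induction h with
  | piece h => exact h.length_ne_zero
  | trans h1 h2 i1 i2 =>
    exact ((pos_iff_ne_zero.2 i1).trans_le (length_mono le_rfl h2.lt.le)).ne'

/-- The Lorentzian distance is positive exactly on the chronological relation. -/
lemma dist_ne_zero_iff : dist g τ p q ≠ 0 ↔ Chron g τ p q := by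
  constructor
  · intro h
    by_contra hn
    refine h (le_antisymm ?_ zero_le)
    rw [dist_eq_sSup]
    refine sSup_le ?_
    rintro _ ⟨γ, a, b, hγ, rfl, rfl, rfl⟩
    by_contra hl
    exact hn (hγ.chron_of_length_ne_zero fun h0 => hl h0.le)
  · intro h
    obtain ⟨γ, a, b, hγ, rfl, rfl⟩ := chron_iff.1 h
    have h1 := (hγ.mono fun _ _ hv => hv.isFutureCausal).length_le_dist
    exact ((pos_iff_ne_zero.2 hγ.length_ne_zero).trans_le h1).ne'

lemma IsPiecewise.length_le_dist_of_chron (h : IsPiecewise (IsFutureCausal g τ) γ a b)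
    (hp : Chron g τ p (γ a)) : length g γ a b ≤ dist g τ p (γ b) := by
  obtain ⟨γ', a', b', hγ', rfl, he⟩ := chron_iff.1 hp
  obtain ⟨η, c, hca, hη, e1, e2, e3⟩ :=
    (hγ'.mono fun _ _ hv => hv.isFutureCausal).exists_glue h he
  rw [← e1, ← e3]
  refine le_trans ?_ hη.length_le_dist
  refine le_trans (le_of_eq ?_) (length_mono hca.le le_rfl)
  rw [length_eq_lintegral_Ioo, length_eq_lintegral_Ioo]
  refine setLIntegral_congr_fun measurableSet_Ioo fun s hs => ?_
  refine (speed_congr ?_).symm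
  filter_upwards [Ioo_mem_nhds hs.1 hs.2] with t ht using e2 ⟨ht.1, ht.2.le⟩

/-- On a causal curve from `q`, the part before the curve enters `I⁺(q)` has length zero, and the
part after it can be preceded by timelike curves from `p`. -/
lemma dist_le_of_chronFuture_subset (h : chronFuture g τ q ⊆ chronFuture g τ p) (r : M) :
    dist g τ q r ≤ dist g τ p r := by
  rw [dist_eq_sSup (p := q)]
  refine sSup_le ?_
  rintro _ ⟨γ, a, b, hγ, rfl, rfl, rfl⟩
  have hab := hγ.lt
  set N : Set ℝ := {t | t ∈ Icc a b ∧ (t = a ∨ ¬ Chron g τ (γ a) (γ t))} with hN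
  have haN : a ∈ N := ⟨left_mem_Icc.2 hab.le, .inl rfl⟩
  have hNb : BddAbove N := ⟨b, fun t ht => ht.1.2⟩
  set t₀ := sSup N with ht₀
  have hat₀ : a ≤ t₀ := le_csSup hNb haN
  have ht₀b : t₀ ≤ b := csSup_le ⟨a, haN⟩ fun t ht => ht.1.2
  set ν : Measure ℝ := volume.withDensity (speed g γ) with hν
  have hνIcc : ∀ s t, ν (Icc s t) = length g γ s t := fun s t =>
    withDensity_apply _ measurableSet_Icc
  have h1 : ν (Ico a t₀) = 0 := by
    rcases hat₀.eq_or_lt with heq | hlt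
    · simp [← heq]
    obtain ⟨u, -, hu, hlim⟩ := exists_seq_strictMono_tendsto' hlt
    refine measure_mono_null (t := ⋃ n, Icc a (u n)) ?_ (measure_iUnion_null fun n => ?_)
    · intro s hs
      obtain ⟨n, hn⟩ := (hlim.eventually (lt_mem_nhds hs.2)).exists
      exact mem_iUnion.2 ⟨n, hs.1, hn.le⟩
    · rw [hνIcc]
      obtain ⟨t, ht, hut⟩ := exists_lt_of_lt_csSup ⟨a, haN⟩ (hu n).2
      have hat : a < t := (hu n).1.trans hut
      have hlen : length g γ a t = 0 := by
        by_contra hl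
        exact ht.2.resolve_left hat.ne'
          ((hγ.restrict_right hat ht.1.2).chron_of_length_ne_zero hl)
      exact le_antisymm ((length_mono le_rfl hut.le).trans hlen.le) zero_le
  have h2 : ν (Ioc t₀ b) ≤ dist g τ p (γ b) := by
    rcases ht₀b.eq_or_lt with heq | hlt
    · simp [heq]
    obtain ⟨u, hanti, hu, hlim⟩ := exists_seq_strictAnti_tendsto' hlt
    have hmono : Monotone fun n => Icc (u n) b := fun m n hmn =>
      Icc_subset_Icc_left (hanti.antitone hmn)
    calc ν (Ioc t₀ b) ≤ ν (⋃ n, Icc (u n) b) := by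
          refine measure_mono fun s hs => ?_
          obtain ⟨n, hn⟩ := (hlim.eventually (gt_mem_nhds hs.1)).exists
          exact mem_iUnion.2 ⟨n, hn.le, hs.2⟩
      _ = ⨆ n, ν (Icc (u n) b) := hmono.measure_iUnion
      _ ≤ dist g τ p (γ b) := by
          refine iSup_le fun n => ?_
          have hau : a < u n := hat₀.trans_lt (hu n).1
          have hch : Chron g τ (γ a) (γ (u n)) := by
            by_contra hc
            exact (hu n).1.not_ge (le_csSup hNb ⟨⟨hau.le, (hu n).2.le⟩, .inr hc⟩)
          rw [hνIcc]
          exact (hγ.restrict_left hau.le (hu n).2).length_le_dist_of_chron (h hch)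
  have h3 : ν {t₀} = 0 := withDensity_absolutelyContinuous _ _ (measure_singleton t₀)
  rw [← hνIcc]
  calc ν (Icc a b) ≤ ν (Ico a t₀ ∪ {t₀} ∪ Ioc t₀ b) := by
        refine measure_mono fun s hs => ?_
        rcases lt_trichotomy s t₀ with h | h | h
        · exact .inl (.inl ⟨hs.1, h⟩)
        · exact .inl (.inr h)
        · exact .inr ⟨h, hs.2⟩
    _ ≤ ν (Ico a t₀) + ν {t₀} + ν (Ioc t₀ b) :=
        (measure_union_le _ _).trans (add_le_add_left (measure_union_le _ _) _)
    _ ≤ dist g τ p (γ b) := by rw [h1, h3, zero_add, zero_add]; exact h2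

/-- `d_q ≤ d_p` is equivalent to `I⁺(q) ⊆ I⁺(p)`. -/
lemma forall_dist_le_iff_chronFuture_subset :
    (∀ r, dist g τ q r ≤ dist g τ p r) ↔ chronFuture g τ q ⊆ chronFuture g τ p := by
  refine ⟨fun h r hr => ?_, dist_le_of_chronFuture_subset⟩
  have hr' : 0 < dist g τ q r := pos_iff_ne_zero.2 (dist_ne_zero_iff.2 hr)
  exact dist_ne_zero_iff.1 (hr'.trans_le (h r)).ne'

/-- `d^p ≤ d^q` is equivalent to `I⁻(p) ⊆ I⁻(q)`. -/
lemma forall_dist_le_iff_chronPast_subset :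
    (∀ r, dist g τ r p ≤ dist g τ r q) ↔ chronPast g τ p ⊆ chronPast g τ q := by
  simp only [← chronFuture_reverse, ← forall_dist_le_iff_chronFuture_subset, dist_reverse]

end Length

/-! ### Reflectivity and causal continuity -/

section Reflecting

variable [FiniteDimensional ℝ E] {g : LorentzianMetric E M} {τ : TimeOrientation g}

lemma mem_closure_chronFuture_iff {p q : M} :
    q ∈ closure (chronFuture g τ p) ↔ chronFuture g τ q ⊆ chronFuture g τ p := by
  refine ⟨fun h r hr => ?_, fun h => closure_mono h (mem_closure_chronFuture q)⟩
  obtain ⟨s, hs, hps⟩ := mem_closure_iff.1 h _ (isOpen_chronPast r) hr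
  exact Chron.trans hps hs

/-- Outer continuity of `I⁺` gives one of the two reflecting properties. -/
lemma chronFuture_subset_of_outerContinuous (h : ∀ x : M, OuterContinuousAt (chronFuture g τ) x)
    {p q : M} (hpq : chronPast g τ p ⊆ chronPast g τ q) :
    chronFuture g τ q ⊆ chronFuture g τ p := by
  rw [← mem_closure_chronFuture_iff]
  by_contra hq
  have hev := h p {q} isCompact_singleton (disjoint_singleton_left.2 hq)
  -- points of `I⁻(p)` arbitrarily close to `p` have `q` in their future
  obtain ⟨y, hy, hyp⟩ := mem_closure_iff_nhds.1 (mem_closure_chronPast (g := g) (τ := τ) p) _ hev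
  exact disjoint_singleton_left.1 hy (subset_closure (hpq hyp))

/-- The two reflecting properties together give the outer continuity of `I⁺`. -/
lemma outerContinuousAt_chronFuture
    (h1 : ∀ p q : M, chronPast g τ p ⊆ chronPast g τ q → chronFuture g τ q ⊆ chronFuture g τ p)
    (h2 : ∀ p q : M, chronFuture g τ q ⊆ chronFuture g τ p → chronPast g τ p ⊆ chronPast g τ q)
    (x : M) : OuterContinuousAt (chronFuture g τ) x := by
  intro K hK hdis
  -- a point `k ∈ K` in the closed futures of all `z ≪ x` has `I⁻(x) ⊆ I⁻(k)`
  have hk : ∀ k ∈ K, ∃ z ∈ chronPast g τ x, k ∉ closure (chronFuture g τ z) := by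
    intro k hkK
    by_contra! hcon
    refine disjoint_left.1 hdis hkK (mem_closure_chronFuture_iff.2 (h1 _ _ fun w hw => ?_))
    obtain ⟨z, hwz, hzx⟩ := Chron.exists_between hw
    exact h2 _ _ (mem_closure_chronFuture_iff.1 (hcon z hzx)) hwz
  choose! z hzx hzk using hk
  obtain ⟨t, htK, hcover⟩ := hK.elim_nhds_subcover (fun k => (closure (chronFuture g τ (z k)))ᶜ)
    fun k hk => isClosed_closure.isOpen_compl.mem_nhds (hzk k hk)
  have hev : ∀ᶠ y in 𝓝 x, ∀ k ∈ t, y ∈ chronFuture g τ (z k) :=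
    (Filter.eventually_all_finset t).2 fun k hk =>
      (isOpen_chronFuture (z k)).mem_nhds (hzx k (htK k hk))
  filter_upwards [hev] with y hy
  rw [disjoint_left]
  intro k hkK hky
  obtain ⟨j, hj, hkj⟩ := mem_iUnion₂.1 (hcover hkK)
  exact hkj (closure_mono (fun w hw => Chron.trans (hy j hj) hw) hky)

lemma outerContinuousAt_chronFuture_reverse {x : M} :
    OuterContinuousAt (chronFuture g τ.reverse) x ↔ OuterContinuousAt (chronPast g τ) x := by
  simp only [OuterContinuousAt, chronFuture_reverse]

/-- Both `I⁺` and `I⁻` are outer continuous if and only if the spacetime is reflecting. -/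
lemma outerContinuous_iff_reflecting :
    ((∀ x : M, OuterContinuousAt (chronFuture g τ) x) ∧
      ∀ x : M, OuterContinuousAt (chronPast g τ) x) ↔
    ∀ p q : M, chronPast g τ p ⊆ chronPast g τ q ↔ chronFuture g τ q ⊆ chronFuture g τ p := by
  constructor
  · rintro ⟨hf, hp⟩ p q
    refine ⟨chronFuture_subset_of_outerContinuous hf, fun h => ?_⟩
    have := chronFuture_subset_of_outerContinuous (τ := τ.reverse)
      (fun x => outerContinuousAt_chronFuture_reverse.2 (hp x)) (p := q) (q := p)
    simp only [chronFuture_reverse, chronPast_reverse] at this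
    exact this h
  · intro h
    refine ⟨outerContinuousAt_chronFuture (fun p q => (h p q).1) (fun p q => (h p q).2),
      fun x => ?_⟩
    rw [← outerContinuousAt_chronFuture_reverse]
    refine outerContinuousAt_chronFuture (fun p q => ?_) (fun p q => ?_) x
    · simpa only [chronFuture_reverse, chronPast_reverse] using (h q p).2
    · simpa only [chronFuture_reverse, chronPast_reverse] using (h q p).1

lemma dReflecting_iff_reflecting : DReflecting g τ ↔
    ∀ p q : M, chronPast g τ p ⊆ chronPast g τ q ↔ chronFuture g τ q ⊆ chronFuture g τ p := by
  simp only [DReflecting, FutureDReflecting, PastDReflecting, forall_dist_le_iff_chronPast_subset,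
    forall_dist_le_iff_chronFuture_subset]
  exact ⟨fun h p q => ⟨h.1 p q, h.2 p q⟩, fun h => ⟨fun p q => (h p q).1, fun p q => (h p q).2⟩⟩

lemma forall_dist_eq_iff_chronFuture_eq {p q : M} :
    (∀ r, dist g τ p r = dist g τ q r) ↔ chronFuture g τ p = chronFuture g τ q := by
  simp only [le_antisymm_iff, forall_and, forall_dist_le_iff_chronFuture_subset]

lemma forall_dist_eq_iff_chronPast_eq {p q : M} :
    (∀ r, dist g τ r p = dist g τ r q) ↔ chronPast g τ p = chronPast g τ q := by
  simp only [le_antisymm_iff, forall_and, forall_dist_le_iff_chronPast_subset]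

lemma weaklyDDistinguishing_iff : WeaklyDDistinguishing g τ ↔
    ∀ p q : M, chronFuture g τ p = chronFuture g τ q → chronPast g τ p = chronPast g τ q →
      p = q := by
  simp only [WeaklyDDistinguishing, forall_dist_eq_iff_chronFuture_eq,
    forall_dist_eq_iff_chronPast_eq]

end Reflecting

end Lorentz

end

theorem mainTheorem6 {E : Type*} [NormedAddCommGroup E] [NormedSpace ℝ E] [FiniteDimensional ℝ E]
    {M : Type*} [TopologicalSpace M] [ChartedSpace E M] [IsManifold 𝓘(ℝ, E) ∞ M]
    [T2Space M] [SecondCountableTopology M] [ConnectedSpace M]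
    (g : Lorentz.LorentzianMetric E M) (τ : Lorentz.TimeOrientation g) :
    Lorentz.CausallyContinuous g τ ↔
      Lorentz.WeaklyDDistinguishing g τ ∧ Lorentz.DReflecting g τ := by
  simp only [Lorentz.CausallyContinuous, Lorentz.outerContinuous_iff_reflecting,
    Lorentz.dReflecting_iff_reflecting, Lorentz.weaklyDDistinguishing_iff, Lorentz.Distinguishing]
  refine and_congr_left fun h => ⟨fun hd p q hf _ => hd.1 p q hf, fun hw => ⟨?_, ?_⟩⟩
  · exact fun p q hf => hw p q hf (((h p q).2 hf.ge).antisymm ((h q p).2 hf.le))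
  · exact fun p q hp => hw p q (((h q p).1 hp.ge).antisymm ((h p q).1 hp.le)) hp
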